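/- Let $\mathbb{k}$ be a field of characteristic zero, $K$ an algebraically closed field containing $\mathbb{k}$, $G$ a finite group, and $V$ a cyclic $\mathbb{k}G$-module, i.e. $\operatorname{Gen}(V) := \{v \in V : V = \mathbb{k}Gv\}$ is non-empty. For $v \in V$ let $\operatorname{Sym}(G,v)$ be the set of all permutations $\pi \in \operatorname{Sym}(G)$ of the set $G$ for which there is $A \in \operatorname{GL}(V)$ with $A(gv) = \pi(g)v$ for all $g \in G$, and let $\operatorname{Sym}(G,V) := \bigcap_{v \in \operatorname{Gen}(V)} \operatorname{Sym}(G,v)$ be the set of generic symmetries with respect to $V$. Let $\chi\colon G \to \mathbb{k} \subseteq K$ be the character of $V$, let $\operatorname{Irr}(G)$ be the set of irreducible characters of $G$ over $K$, and put $\langle \chi, \psi\rangle := \frac{1}{|G|}\sum_{g \in G} \chi(g)\psi(g^{-1})$. The ideal part of $\chi$ is \[ \chi_I := \sum_{\psi \in \operatorname{Irr}(G),\ \langle \chi,\psi\rangle = \psi(1)} \psi(1)\,\psi, \] and we let $N := \operatorname{Ker}(\chi-\chi_I) = \{g \in G : (\chi-\chi_I)(g) = (\chi-\chi_I)(1)\}$.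 Then a permutation $\pi \in \operatorname{Sym}(G)$ belongs to $\operatorname{Sym}(G,V)$ if and only if the following two conditions hold: (a) $\chi_I(\pi(h)^{-1}\pi(g)) = \chi_I(h^{-1}g)$ for all $g, h \in G$, and (b) $\pi(gN) = \pi(1)gN$ (as sets) for all $g \in G$. -/

import Mathlib

open scoped Pointwise

noncomputable section

namespace GenericSymmetry

section Symmetries

variable {k G V : Type*} [Field k] [Group G] [AddCommGroup V] [Module k V]

/-- The set `Gen(V)` of generators of the `kG`-module `V` given by `ρ`: the vectors `v` such that
the orbit `Gv` spans `V` over `k`, i.e. `V = kGv`. -/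
def generators (ρ : Representation k G V) : Set V :=
  {v | Submodule.span k (Set.range fun g : G => ρ g v) = ⊤}

/-- `V` is cyclic as a `kG`-module if it has a generator. -/
def IsCyclicRep (ρ : Representation k G V) : Prop :=
  (generators ρ).Nonempty

/-- `Sym(G, v)`: the permutations `π` of the set `G` for which some `A ∈ GL(V)` satisfies
`A (g v) = π(g) v` for all `g ∈ G` (the orbit symmetries with respect to `v`). -/
def orbitSymmetries (ρ : Representation k G V) (v : V) : Set (Equiv.Perm G) :=
  {π | ∃ A : V ≃ₗ[k] V, ∀ g : G, A (ρ g v) = ρ (π g) v}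

/-- `Sym(G, V)`: the generic symmetries, i.e. the intersection of the sets `Sym(G, v)` over all
generators `v` of `V`. -/
def genericSymmetries (ρ : Representation k G V) : Set (Equiv.Perm G) :=
  ⋂ v ∈ generators ρ, orbitSymmetries ρ v

end Symmetries

section Characters

variable (K G : Type*) [Field K] [Group G]

/-- `Irr(G)`: the set of characters of the irreducible representations of `G` over `K`, which for
finite `G` are all finite dimensional and hence realized on some `Kⁿ`. -/
def Irr : Set (G → K) :=
  {ψ | ∃ (n : ℕ) (σ : Representation K G (Fin n → K)), σ.IsIrreducible ∧ ψ = σ.character}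

variable {K G}

/-- The usual inner product `⟨α, β⟩ = |G|⁻¹ ∑ α(g) β(g⁻¹)` of class functions. For characters over
`ℂ` one has `β(g⁻¹) = conj β(g)`. -/
def charInner [Fintype G] (α β : G → K) : K :=
  (Nat.card G : K)⁻¹ * ∑ g : G, α g * β g⁻¹

theorem charInner_irr [Fintype G] [CharZero K] [IsAlgClosed K] {ψ θ : G → K}
    (hψ : ψ ∈ Irr K G) (hθ : θ ∈ Irr K G) :
    (ψ = θ → charInner ψ θ = 1) ∧ (ψ ≠ θ → charInner ψ θ = 0) := by
  obtain ⟨n, σ, hσ, rfl⟩ := hψ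
  obtain ⟨m, τ, hτ, rfl⟩ := hθ
  have hne : (Nat.card G : K) ≠ 0 := by
    exact_mod_cast Nat.card_pos.ne'
  let _ : Invertible (Nat.card G : K) := invertibleOfNonzero hne
  constructor
  · intro h
    rw [← h, charInner, Representation.char_orthonormal σ σ,
      if_pos ⟨Representation.Equiv.refl σ⟩]
  · intro h
    rw [charInner, Representation.char_orthonormal σ τ, if_neg]
    rintro ⟨φ⟩
    exact h (Representation.char_iso φ).symm

/-- A finite group has only finitely many irreducible characters. -/
theorem irr_finite (K G : Type*) [Field K] [Group G] [Fintype G] [CharZero K] [IsAlgClosed K] :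
    (Irr K G).Finite := by
  have hli : LinearIndependent K (fun ψ : Irr K G => (ψ : G → K)) := by
    rw [linearIndependent_iff']
    intro s c hc i hi
    have h0 : charInner (∑ j ∈ s, c j • (j : G → K)) (i : G → K) = 0 := by
      rw [hc]; simp [charInner]
    have h1 : charInner (∑ j ∈ s, c j • (j : G → K)) (i : G → K)
        = ∑ j ∈ s, c j * charInner (j : G → K) (i : G → K) := by
      simp only [charInner, Finset.sum_apply, Pi.smul_apply, smul_eq_mul, Finset.sum_mul,
        Finset.mul_sum]
      rw [Finset.sum_comm]
      refine Finset.sum_congr rfl fun j _ => Finset.sum_congr rfl fun g _ => by ring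
    rw [h1, Finset.sum_eq_single i, (charInner_irr i.2 i.2).1 rfl, mul_one] at h0
    · exact h0
    · intro j _ hji
      rw [(charInner_irr j.2 i.2).2 fun h => hji (Subtype.ext h), mul_zero]
    · exact fun h => absurd hi h
  exact Set.finite_coe_iff.mp hli.finite

/-- The ideal part `χ_I` of `χ`: the sum of `ψ(1) ψ` over all irreducible characters `ψ` of `G`
with `⟨χ, ψ⟩ = ψ(1)`. -/
def idealPart [Fintype G] [CharZero K] [IsAlgClosed K] (χ : G → K) : G → K :=
  open Classical in
  ∑ ψ ∈ (irr_finite K G).toFinset with charInner χ ψ = ψ 1, ψ 1 • ψ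

/-- The kernel `Ker(θ) = {g : θ(g) = θ(1)}` of a character `θ` (in characteristic zero, the kernel
of any representation affording `θ`). -/
def charKer (θ : G → K) : Set G :=
  {g | θ g = θ 1}

end Characters

end GenericSymmetry

end

noncomputable section

namespace GenericSymmetry

open Matrix Module TensorProduct

/-! ### Modules over a product of matrix algebras -/

section Blocks

/-! Over K the group algebra A = KG is a product of matrix algebras of sizes d_i; let m_i be the
multiplicity of block i in W = K ⊗ V. Cyclicity gives m_i ≤ d_i. Call a block full if m_i = d_i and
occurring if m_i ≠ 0. Let T be the operator on A with T(g) = π(g). By `mem_orbitSymmetries_iff`, π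
lies in Sym(G, v) exactly when T, taken over k, preserves the annihilator of the generator v.

Let e be the central idempotent of the full blocks. Right multiplication by e has matrix C with
entries χ_I(h⁻¹g)/|G| in the basis G, so (a) says that T commutes with it. Condition (b) says that T
is left multiplication by π(1) on the occurring blocks that are not full: N consists of the elements
acting trivially there, because a sum of m roots of unity has real part m only if all of them are 1.

Sufficiency: if xv = 0, then x vanishes in the full blocks, hence so does Tx by (a). By (b), Tx and
π(1)x then act equally on W, so (Tx)v = 0.

Necessity: a density argument (`twistedSum_eq_zero_of_forall`) shows that T preserves the
annihilator of uv for every unit u of A. A non-full block contains rank one elements killing uv for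
suitable u, and varying u forces T to map this block to zero in every other occurring block and, if
it occurs, to act on it as a left multiplication. In particular T preserves the kernel of right
multiplication by e. With D the matrix obtained from C by relabelling along π, this reads DC = D.
The entries are algebraic numbers, so they embed in ℂ even if K does not; there C and D are
orthogonal projections of equal trace, so C = D, which is (a). Now T also keeps the full blocks out
of the others, and evaluating at 1 and g gives (b). -/

/-- A finite product of full matrix algebras. -/
abbrev MatProd (K : Type*) {ι : Type*} (d : ι → ℕ) : Type _ :=
  ∀ i, Matrix (Fin (d i)) (Fin (d i)) K

variable {K ι : Type*} [Field K] [Fintype ι] [DecidableEq ι] {d : ι → ℕ}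

/-- The matrix unit in position `(j, k)` of the block `i`. -/
def blockUnit (K : Type*) [Field K] {ι : Type*} [DecidableEq ι] {d : ι → ℕ}
    (i : ι) (j k : Fin (d i)) : MatProd K d :=
  Pi.single i (Matrix.single j k 1)

/-- The matrix `y μᵀ` in the block `i`. -/
def blockRankOne (i : ι) (y μ : Fin (d i) → K) : MatProd K d :=
  Pi.single i (vecMulVec y μ)

omit [Fintype ι] in
theorem blockUnit_mul (i : ι) (j k l : Fin (d i)) :
    blockUnit K i j k * blockUnit K i k l = blockUnit K i j l := by
  simp [blockUnit, ← Pi.single_mul]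

omit [Fintype ι] in
theorem blockUnit_mul_mul (x : MatProd K d) (i : ι) (a j k b : Fin (d i)) :
    blockUnit K i a j * x * blockUnit K i k b = x i j k • blockUnit K i a b := by
  ext i' : 1
  rcases eq_or_ne i' i with rfl | h
  · simp [blockUnit, Matrix.smul_single]
  · simp [blockUnit, Pi.single_eq_of_ne h]

theorem eq_sum_blockUnit (x : MatProd K d) :
    x = ∑ i, ∑ j, ∑ k, x i j k • blockUnit K i j k := by
  conv_lhs => rw [← Finset.univ_sum_single x]
  refine Finset.sum_congr rfl fun i _ => ?_
  conv_lhs => rw [matrix_eq_sum_single (x i)]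
  have h (f : Fin (d i) → Fin (d i) → Matrix (Fin (d i)) (Fin (d i)) K) :
      (Pi.single i (∑ j, ∑ k, f j k) : MatProd K d) = ∑ j, ∑ k, Pi.single i (f j k) := by
    change AddMonoidHom.single (fun i => Matrix (Fin (d i)) (Fin (d i)) K) i _ = _
    simp [map_sum]
  rw [h]
  refine Finset.sum_congr rfl fun j _ => Finset.sum_congr rfl fun k _ => ?_
  rw [blockUnit, ← Pi.single_smul, Matrix.smul_single, smul_eq_mul, mul_one]

variable [∀ i, NeZero (d i)]

/-- A trace functional on a product of matrix algebras is a combination of the traces of the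
blocks. -/
theorem eq_sum_trace_of_mul_comm (f : MatProd K d →ₗ[K] K) (hf : ∀ x y, f (x * y) = f (y * x))
    (x : MatProd K d) : f x = ∑ i, f (blockUnit K i 0 0) * (x i).trace := by
  have hu (i : ι) (j k : Fin (d i)) :
      f (blockUnit K i j k) = if j = k then f (blockUnit K i 0 0) else 0 := by
    rw [← blockUnit_mul i j 0 k, hf]
    split_ifs with h
    · rw [h, blockUnit_mul]
    · simp [blockUnit, ← Pi.single_mul, Ne.symm h]
  conv_lhs => rw [eq_sum_blockUnit x]
  simp only [map_sum, map_smul, smul_eq_mul]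
  refine Finset.sum_congr rfl fun i _ => ?_
  rw [Matrix.trace, Finset.mul_sum]
  refine Finset.sum_congr rfl fun j _ => ?_
  rw [Finset.sum_eq_single j (fun k _ hk => by rw [hu, if_neg hk.symm, mul_zero]) (by simp), hu,
    if_pos rfl, mul_comm, Matrix.diag]

variable {W : Type*} [AddCommGroup W] [Module K W]

/-- The multiplicity of the simple module of the block `i` in the module given by `α`. -/
def blockMult (α : MatProd K d →ₐ[K] End K W) (i : ι) : ℕ :=
  finrank K (LinearMap.range (α (blockUnit K i 0 0)))

omit [Fintype ι] in
theorem blockUnit_eq_one_mul (i : ι) (j k : Fin (d i)) :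
    blockUnit K i j k = blockUnit K i j 0 * blockUnit K i 0 0 * blockUnit K i 0 k := by
  rw [blockUnit_mul, blockUnit_mul]

section FiniteDimensional

variable [FiniteDimensional K W] (α : MatProd K d →ₐ[K] End K W)

/-- The coefficient of a block is the trace of its idempotent diagonal matrix unit, which is the
rank. -/
theorem trace_apply_eq_sum (x : MatProd K d) :
    LinearMap.trace K W (α x) = ∑ i, (blockMult α i : K) * (x i).trace := by
  refine (eq_sum_trace_of_mul_comm (LinearMap.trace K W ∘ₗ α.toLinearMap) ?_ x).trans ?_
  · intro x y
    simp [LinearMap.trace_mul_comm K (α x) (α y)]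
  · refine Finset.sum_congr rfl fun i _ => ?_
    have h : IsIdempotentElem (α (blockUnit K i 0 0)) := by
      rw [IsIdempotentElem, ← map_mul, blockUnit_mul]
    rw [blockMult, ← (LinearMap.IsIdempotentElem.isProj_range _ h).trace]
    rfl

omit [Fintype ι] in
theorem blockMult_eq_zero_iff (i : ι) : blockMult α i = 0 ↔ α (blockUnit K i 0 0) = 0 := by
  rw [blockMult, Submodule.finrank_eq_zero, LinearMap.range_eq_bot]

/-- Sandwiching x between matrix units isolates a single entry times a diagonal unit, so the kernel
is the sum of the blocks of multiplicity zero. -/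
theorem apply_eq_zero_iff (x : MatProd K d) :
    α x = 0 ↔ ∀ i, blockMult α i ≠ 0 → x i = 0 := by
  constructor
  · intro hx i hi
    ext j k
    have h : x i j k • α (blockUnit K i 0 0) = 0 := by
      rw [← map_smul, ← blockUnit_mul_mul x i 0 j k 0, map_mul, map_mul, hx]; simp
    exact (smul_eq_zero.mp h).resolve_right (mt (blockMult_eq_zero_iff α i).mpr hi)
  · intro h
    rw [eq_sum_blockUnit x]
    simp only [map_sum, map_smul]
    refine Finset.sum_eq_zero fun i _ => Finset.sum_eq_zero fun j _ => Finset.sum_eq_zero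
      fun k _ => ?_
    by_cases hi : blockMult α i = 0
    · rw [blockUnit_eq_one_mul, map_mul, map_mul, (blockMult_eq_zero_iff α i).mp hi]; simp
    · simp [h i hi]

/-- The vector `μ` of a block, seen as the first row of a matrix and applied to `v`. -/
def rowApply (i : ι) (v : W) :
    (Fin (d i) → K) →ₗ[K] LinearMap.range (α (blockUnit K i 0 0)) where
  toFun μ := ⟨α (blockRankOne i (Pi.single 0 1) μ) v, by
    refine ⟨α (blockRankOne i (Pi.single 0 1) μ) v, ?_⟩
    rw [← Module.End.mul_apply, ← map_mul]
    congr 2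
    rw [blockUnit, blockRankOne, ← Pi.single_mul, mul_vecMulVec]
    congr 2
    ext j
    simp [Matrix.single_apply, Pi.single_apply, eq_comm]⟩
  map_add' μ ν := by
    ext
    simp [blockRankOne, vecMulVec_add, Pi.single_add]
  map_smul' c μ := by
    ext
    simp [blockRankOne, vecMulVec_smul, Pi.single_smul]

omit [Fintype ι] [∀ i, NeZero (d i)] in
theorem blockUnit_mul_eq (i : ι) (j k : Fin (d i)) (x : MatProd K d) :
    blockUnit K i j k * x = blockRankOne i (Pi.single j 1) (fun l => x i k l) := by
  ext i' : 1
  rcases eq_or_ne i' i with rfl | h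
  · simp only [blockUnit, blockRankOne, Pi.mul_apply, Pi.single_eq_same]
    ext a b
    rw [vecMulVec_apply, Pi.single_apply]
    split_ifs with h
    · rw [h, single_mul_apply_same]
    · rw [single_mul_apply_of_ne _ _ _ _ _ h, zero_mul]
  · simp [blockUnit, blockRankOne, Pi.single_eq_of_ne h]

variable {v : W} (hv : ∀ w, ∃ x, α x v = w)
include hv

omit [Fintype ι] [FiniteDimensional K W] in
-- Since W = Av, the image of a diagonal matrix unit is reached by applying one row of an algebra
-- element to v. The row space has dimension d i, so comparing it with `blockMult` decides whether a
-- nonzero row can kill v.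
theorem rowApply_surjective (i : ι) : Function.Surjective (rowApply α i v) := by
  rintro ⟨w, u, rfl⟩
  obtain ⟨x, rfl⟩ := hv u
  refine ⟨fun l => x i 0 l, Subtype.ext ?_⟩
  change α _ v = _
  rw [← blockUnit_mul_eq, map_mul, Module.End.mul_apply]

omit [Fintype ι] [FiniteDimensional K W] in
theorem blockMult_le (i : ι) : blockMult α i ≤ d i := by
  rw [blockMult, ← finrank_top, ← LinearMap.range_eq_top.mpr (rowApply_surjective α hv i)]
  exact (LinearMap.finrank_range_le _).trans (by simp)

omit [Fintype ι] in
-- At full multiplicity `rowApply` is bijective, and every row of `x i` lies in its kernel.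
theorem block_eq_zero_of_apply_eq_zero {i : ι} (hi : blockMult α i = d i) {x : MatProd K d}
    (hx : α x v = 0) : x i = 0 := by
  have hinj : Function.Injective (rowApply α i v) :=
    (LinearMap.injective_iff_surjective_of_finrank_eq_finrank
      (by rw [finrank_fin_fun]; exact hi.symm)).mpr
      (rowApply_surjective α hv i)
  ext j k
  have h : rowApply α i v (fun l => x i j l) = 0 := by
    refine Subtype.ext ?_
    change α _ v = 0
    rw [← blockUnit_mul_eq, map_mul, Module.End.mul_apply, hx, map_zero]
  simpa using congrFun (hinj (h.trans (map_zero _).symm)) k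

omit [Fintype ι] in
theorem exists_blockRankOne_apply_eq_zero {i : ι} (hi : blockMult α i ≠ d i) :
    ∃ μ : Fin (d i) → K, μ ≠ 0 ∧ ∀ y, α (blockRankOne i y μ) v = 0 := by
  have hlt := lt_of_le_of_ne (blockMult_le α hv i) hi
  have hker : LinearMap.ker (rowApply α i v) ≠ ⊥ :=
    LinearMap.ker_ne_bot_of_finrank_lt (by rw [finrank_fin_fun]; exact hlt)
  obtain ⟨μ, hμ, h0⟩ := (Submodule.ne_bot_iff _).mp hker
  refine ⟨μ, h0, fun y => ?_⟩
  have h : α (blockRankOne i (Pi.single 0 1) μ) v = 0 := congrArg Subtype.val hμ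
  have e : (blockRankOne i y μ : MatProd K d) =
      blockRankOne i y (Pi.single 0 1) * blockRankOne i (Pi.single 0 1) μ := by
    simp [blockRankOne, ← Pi.single_mul, vecMulVec_mul_vecMulVec]
  rw [e, map_mul, Module.End.mul_apply, h, map_zero]

end FiniteDimensional

/-- The general linear group acts transitively on nonzero row vectors. -/
theorem exists_isUnit_vecMul_eq {n : ℕ} {x y : Fin n → K} (hx : x ≠ 0) (hy : y ≠ 0) :
    ∃ g : Matrix (Fin n) (Fin n) K, IsUnit g ∧ x ᵥ* g = y := by
  obtain ⟨f, hf⟩ := Submodule.exists_linearEquiv_restrict_eq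
    ((LinearEquiv.toSpanNonzeroSingleton K _ x hx).symm.trans
      (LinearEquiv.toSpanNonzeroSingleton K _ y hy))
  have hfx : f x = y := by
    have h : (LinearEquiv.toSpanNonzeroSingleton K _ x hx).symm
        ⟨x, Submodule.mem_span_singleton_self x⟩ = 1 := by
      rw [LinearEquiv.symm_apply_eq]; simp
    simpa [h] using (hf ⟨x, Submodule.mem_span_singleton_self x⟩).symm
  refine ⟨(LinearMap.toMatrix' f.toLinearMap)ᵀ, ?_, ?_⟩
  · rw [isUnit_transpose]
    exact (LinearMap.isUnit_toMatrix'_iff).mpr ((Module.End.isUnit_iff _).mpr f.bijective)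
  · rw [vecMul_transpose, LinearMap.toMatrix'_mulVec]
    exact hfx

omit [DecidableEq ι] [∀ i, NeZero (d i)] in
/-- In a product of matrix algebras over an infinite field, every element becomes invertible after
adding a suitable scalar. -/
theorem exists_isUnit_add_algebraMap [Infinite K] (x : MatProd K d) :
    ∃ t : K, IsUnit (x + algebraMap K (MatProd K d) t) := by
  have hfin : (⋃ i, spectrum K (-x i)).Finite :=
    Set.finite_iUnion fun i => Matrix.finite_spectrum _
  obtain ⟨t, ht⟩ := hfin.exists_notMem
  refine ⟨t, Pi.isUnit_iff.mpr fun i => ?_⟩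
  have h := spectrum.notMem_iff.mp (fun h => ht (Set.mem_iUnion.mpr ⟨i, h⟩))
  rw [sub_neg_eq_add, add_comm] at h
  exact h

/-- A linear operator on matrices that preserves the left ideals of matrices annihilating a given
vector, on rank one matrices, is a left multiplication. -/
theorem eq_mul_of_forall_vecMulVec {n : ℕ}
    (t : Matrix (Fin n) (Fin n) K →ₗ[K] Matrix (Fin n) (Fin n) K)
    (h : ∀ y μ z, μ ⬝ᵥ z = 0 → t (vecMulVec y μ) *ᵥ z = 0) (a : Matrix (Fin n) (Fin n) K) :
    t a = t 1 * a := by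
  let e (j : Fin n) : Fin n → K := Pi.single j 1
  let E (j k : Fin n) : Matrix (Fin n) (Fin n) K := vecMulVec (e j) (e k)
  have hE (j k) : E j k = Matrix.single j k 1 := (single_eq_single_vecMulVec_single j k).symm
  have h1 (j k l) (hkl : k ≠ l) : t (E j k) *ᵥ e l = 0 := h _ _ _ (by simp [e, hkl])
  have h2 (j k l) : t (E j k) *ᵥ e k = t (E j l) *ᵥ e l := by
    rcases eq_or_ne k l with rfl | hkl
    · rfl
    -- Orthogonality of e_k + e_l and e_k - e_l makes the only nonzero column of t(E j k)
    -- independent of k.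
    have := h (e j) (e k + e l) (e k - e l) (by simp [e, hkl, hkl.symm])
    rw [vecMulVec_add, map_add, add_mulVec, mulVec_sub, mulVec_sub] at this
    change t (E j k) *ᵥ e k - t (E j k) *ᵥ e l + (t (E j l) *ᵥ e k - t (E j l) *ᵥ e l) = 0 at this
    rw [h1 j k l hkl, h1 j l k hkl.symm, sub_zero, zero_sub, ← sub_eq_add_neg] at this
    exact sub_eq_zero.mp this
  have h3 (j) : t 1 *ᵥ e j = t (E j j) *ᵥ e j := by
    have : (1 : Matrix (Fin n) (Fin n) K) = ∑ l, E l l := by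
      simp only [hE, Matrix.sum_single_one]
    rw [this, map_sum, sum_mulVec, Finset.sum_eq_single j (fun l _ hl => h1 l l j hl) (by simp)]
  have h4 (j k) : t (E j k) = t 1 * E j k := by
    refine Matrix.ext_of_mulVec_single fun l => ?_
    change t (E j k) *ᵥ e l = (t 1 * E j k) *ᵥ e l
    rw [← mulVec_mulVec, vecMulVec_mulVec]
    rcases eq_or_ne k l with rfl | hkl
    · simp [e, h2 j k j, h3]
    · rw [h1 _ _ _ hkl]; simp [e, hkl]
  rw [matrix_eq_sum_single a]
  simp only [map_sum, Finset.mul_sum]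
  refine Finset.sum_congr rfl fun j _ => Finset.sum_congr rfl fun k _ => ?_
  have : Matrix.single j k (a j k) = a j k • E j k := by rw [hE]; simp [Matrix.smul_single]
  rw [this, map_smul, h4, Matrix.mul_smul]

/-! ### Operators preserving the annihilators of all generators -/

section GenericOperator

variable [Infinite K] [FiniteDimensional K W] (α : MatProd K d →ₐ[K] End K W)
  (T : MatProd K d →ₗ[K] MatProd K d) {v : W} (hv : ∀ w, ∃ x, α x v = w)
  (hT : ∀ u x : MatProd K d, IsUnit u → α x (α u v) = 0 → α (T x) (α u v) = 0)
include hv hT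

/-- An operator preserving the annihilators of all generators preserves the set of rank one
elements annihilating a given vector, in the blocks that do not occur with full multiplicity. -/
theorem apply_blockRankOne_eq_zero {i : ι} (hi : blockMult α i ≠ d i) (y μ : Fin (d i) → K) (w : W)
    (hw : α (blockRankOne i y μ) w = 0) : α (T (blockRankOne i y μ)) w = 0 := by
  rcases eq_or_ne μ 0 with rfl | hμ
  · simp [blockRankOne]
  -- Some row ν of the block kills v. Moving μ to ν by a unit u gives a generator uv killed by y μᵀ.
  obtain ⟨ν, hν, hνv⟩ := exists_blockRankOne_apply_eq_zero α hv hi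
  obtain ⟨g, hg, hμg⟩ := exists_isUnit_vecMul_eq hμ hν
  set u : MatProd K d := Function.update 1 i g with hu
  have huu : IsUnit u := by
    refine Pi.isUnit_iff.mpr fun i' => ?_
    rcases eq_or_ne i' i with rfl | h
    · simpa [hu] using hg
    · simp [hu, h]
  have h1 : α (blockRankOne i y μ) (α u v) = 0 := by
    rw [← Module.End.mul_apply, ← map_mul]
    convert hνv y using 3
    ext i' : 1
    rcases eq_or_ne i' i with rfl | h
    · simp [hu, blockRankOne, vecMulVec_mul, hμg]
    · simp [blockRankOne, Pi.single_eq_of_ne h]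
  have hc : ∃ c, α c (α u v) = w := by
    obtain ⟨c, hc⟩ := hv w
    obtain ⟨u', hu'⟩ := huu.exists_left_inv
    refine ⟨c * u', ?_⟩
    rw [← Module.End.mul_apply, ← map_mul, mul_assoc, hu', mul_one, hc]
  obtain ⟨c, rfl⟩ := hc
  -- Write w = c(uv). With c + t a unit, w + t·uv is again a unit multiple of v killed by y μᵀ. The
  -- hypothesis applies to it and to uv, hence to the difference w.
  obtain ⟨t, ht⟩ := exists_isUnit_add_algebraMap c
  have h2 := hT u _ huu h1
  have h3 := hT _ (blockRankOne i y μ) (ht.mul huu) (by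
    rw [map_mul, Module.End.mul_apply, map_add, LinearMap.add_apply, map_add, hw, AlgHom.commutes,
      Module.algebraMap_end_apply, map_smul, h1, smul_zero, add_zero])
  rwa [map_mul, Module.End.mul_apply, map_add, LinearMap.add_apply, map_add, AlgHom.commutes,
    Module.algebraMap_end_apply, map_smul, h2, smul_zero, add_zero] at h3

/-- Rank one elements of block i kill the part of W belonging to block j, hence so do their images
under T; block j acts faithfully there. -/
theorem apply_single_eq_zero_of_ne {i j : ι} (hi : blockMult α i ≠ d i) (hj : blockMult α j ≠ 0)
    (hij : j ≠ i) (a : Matrix (Fin (d i)) (Fin (d i)) K) : T (Pi.single i a) j = 0 := by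
  have h (y μ) : T (blockRankOne i y μ) j = 0 := by
    have h0 : α (T (blockRankOne i y μ) * Pi.single j 1) = 0 := by
      ext w
      rw [map_mul, Module.End.mul_apply]
      refine apply_blockRankOne_eq_zero α T hv hT hi y μ _ ?_
      rw [← Module.End.mul_apply, ← map_mul]
      have : (blockRankOne i y μ : MatProd K d) * Pi.single j 1 = 0 := by
        ext l : 1
        rcases eq_or_ne l i with rfl | h
        · simp [Pi.single_eq_of_ne hij.symm]
        · simp [blockRankOne, Pi.single_eq_of_ne h]
      rw [this, map_zero, LinearMap.zero_apply]
    simpa using (apply_eq_zero_iff α _).mp h0 j hj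
  rw [eq_sum_blockUnit (Pi.single i a : MatProd K d)]
  simp only [map_sum, map_smul, Finset.sum_apply, Pi.smul_apply]
  refine Finset.sum_eq_zero fun l _ => Finset.sum_eq_zero fun p _ => Finset.sum_eq_zero fun q _ => ?_
  rcases eq_or_ne l i with rfl | hl
  · have e : (blockUnit K l p q : MatProd K d) =
        blockRankOne l (Pi.single p 1) (Pi.single q 1) := by
      rw [blockUnit, blockRankOne, single_eq_single_vecMulVec_single]
    rw [e, h, smul_zero]
  · simp [Pi.single_eq_of_ne hl]

/-- If μ ⬝ z = 0, then y μᵀ kills the image of z e₀ᵀ on W, and so does its image under T.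
Faithfulness of the block turns this into the hypothesis of `eq_mul_of_forall_vecMulVec`. -/
theorem apply_single_eq_mul {i : ι} (hi : blockMult α i ≠ d i) (h0 : blockMult α i ≠ 0)
    (a : Matrix (Fin (d i)) (Fin (d i)) K) :
    T (Pi.single i a) i = T (Pi.single i 1) i * a := by
  refine eq_mul_of_forall_vecMulVec
    (LinearMap.proj i ∘ₗ T ∘ₗ LinearMap.single K (fun i => Matrix (Fin (d i)) (Fin (d i)) K) i)
    (fun y μ z hμz => ?_) a
  change T (blockRankOne i y μ) i *ᵥ z = 0
  have h1 : α (T (blockRankOne i y μ) * blockRankOne i z (Pi.single 0 1)) = 0 := by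
    ext w
    rw [map_mul, Module.End.mul_apply]
    refine apply_blockRankOne_eq_zero α T hv hT hi y μ _ ?_
    rw [← Module.End.mul_apply, ← map_mul]
    simp [blockRankOne, ← Pi.single_mul, vecMulVec_mul_vecMulVec, hμz]
  have h2 := (apply_eq_zero_iff α _).mp h1 i h0
  rw [Pi.mul_apply, show (blockRankOne i z (Pi.single 0 1) : MatProd K d) i = _ from
    Pi.single_eq_same _ _, mul_vecMulVec] at h2
  ext j
  simpa [vecMulVec_apply] using congrFun (congrFun h2 j) 0

end GenericOperator

omit [Fintype ι] in
theorem blockMult_lmul (i : ι) : blockMult (Algebra.lmul K (MatProd K d)) i = d i := by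
  have hs := rowApply_surjective (Algebra.lmul K (MatProd K d)) (v := 1)
    (fun w => ⟨w, by simp⟩) i
  have hinj : Function.Injective (rowApply (Algebra.lmul K (MatProd K d)) i 1) := by
    rw [← LinearMap.ker_eq_bot, Submodule.eq_bot_iff]
    intro μ hμ
    have h : (blockRankOne i (Pi.single 0 1) μ : MatProd K d) * 1 = 0 := congrArg Subtype.val hμ
    rw [mul_one] at h
    simpa [blockRankOne] using h
  rw [blockMult, ← (LinearEquiv.ofBijective _ ⟨hinj, hs⟩).finrank_eq, finrank_fin_fun]

end Blocks

/-! ### Sums of roots of unity, transported to ℂ -/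

theorem nonempty_algebraicClosure_ringHom (F K L : Type*) [Field F] [Field K] [Field L]
    [Algebra F K] [Algebra F L] [IsAlgClosed L] : Nonempty (algebraicClosure F K →+* L) :=
  ⟨(IsAlgClosed.lift : algebraicClosure F K →ₐ[F] L).toRingHom⟩

section RootsOfUnity

variable {K : Type*} [Field K] [CharZero K] [IsAlgClosed K]

theorem exists_trace_pow_eq_sum {m n : ℕ} [NeZero n] (M : Matrix (Fin m) (Fin m) K)
    (hM : M ^ n = 1) :
    ∃ (ζ : Fin n → K) (c : Fin n → ℕ), (∀ j, ζ j ^ n = 1) ∧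
      (∀ k : ℕ, (M ^ k).trace = ∑ j, (c j : K) * ζ j ^ k) ∧ ((∀ j, c j ≠ 0 → ζ j = 1) → M = 1) := by
  obtain ⟨ω, hω⟩ := HasEnoughRootsOfUnity.exists_primitiveRoot K n
  have hn : (n : K) ≠ 0 := NeZero.ne _
  have hω0 : ω ≠ 0 := hω.ne_zero (NeZero.ne n)
  let N (j : Fin n) : Matrix (Fin m) (Fin m) K := (ω ^ (j : ℕ))⁻¹ • M
  -- The projection onto the eigenspace of M for ω ^ j; its rank is the multiplicity c j.
  let p (j : Fin n) : Matrix (Fin m) (Fin m) K := (n : K)⁻¹ • ∑ k ∈ Finset.range n, N j ^ k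
  have hζ (j : Fin n) : (ω ^ (j : ℕ)) ^ n = 1 := by rw [← pow_mul, mul_comm, pow_mul, hω.1, one_pow]
  have hN (j) : N j ^ n = 1 := by
    simp only [N, smul_pow, hM, inv_pow, hζ, inv_one, one_smul]
  have hNp (j) : N j * p j = p j := by
    have := mul_geom_sum (N j) n
    rw [hN, sub_self, sub_mul, one_mul, sub_eq_zero] at this
    simp only [p, Matrix.mul_smul, this]
  have hNkp (j) (k : ℕ) : N j ^ k * p j = p j := by
    induction k with
    | zero => simp
    | succ k ih => rw [pow_succ, mul_assoc, hNp, ih]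
  have hMkp (j) (k : ℕ) : M ^ k * p j = (ω ^ (j : ℕ)) ^ k • p j := by
    have h := hNkp j k
    have h1 : M = ω ^ (j : ℕ) • N j := by
      simp [N, smul_smul, hω0]
    rw [h1, smul_pow, Matrix.smul_mul, h]
  have hpp (j) : p j * p j = p j := by
    conv_lhs => enter [1]; simp only [p]
    rw [Matrix.smul_mul, Finset.sum_mul, Finset.sum_congr rfl fun k _ => hNkp j k, Finset.sum_const,
      Finset.card_range, ← Nat.cast_smul_eq_nsmul K, smul_smul, inv_mul_cancel₀ hn, one_smul]
  have hsum : ∑ j, p j = 1 := by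
    simp only [p, N, smul_pow, ← Finset.smul_sum]
    rw [Finset.sum_comm, Finset.sum_eq_single 0]
    · simp only [pow_zero, one_smul, Finset.sum_const, Finset.card_univ, Fintype.card_fin]
      rw [← Nat.cast_smul_eq_nsmul K, smul_smul, inv_mul_cancel₀ hn, one_smul]
    · intro k hk hk0
      rw [← Finset.sum_smul]
      have h1 : ω⁻¹ ^ k ≠ 1 :=
        hω.inv.pow_ne_one_of_pos_of_lt hk0 (Finset.mem_range.mp hk)
      have h2 := mul_geom_sum (ω⁻¹ ^ k) n
      rw [← pow_mul, mul_comm k n, pow_mul, hω.inv.1, one_pow, sub_self] at h2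
      have h3 := (mul_eq_zero.mp h2).resolve_left (sub_ne_zero.mpr h1)
      rw [← Fin.sum_univ_eq_sum_range (fun i => (ω⁻¹ ^ k) ^ i)] at h3
      have h4 : ∑ j : Fin n, (ω ^ (j : ℕ))⁻¹ ^ k = 0 := by
        rw [← h3]
        refine Finset.sum_congr rfl fun j _ => ?_
        rw [← inv_pow, ← pow_mul, ← pow_mul, mul_comm]
      rw [h4, zero_smul]
    · intro h
      exact absurd (Finset.mem_range.mpr (NeZero.pos n)) h
  refine ⟨fun j => ω ^ (j : ℕ), fun j => finrank K (LinearMap.range (toLin' (p j))), hζ,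
    fun k => ?_, fun h => ?_⟩
  · have ht (j) : (p j).trace = (finrank K (LinearMap.range (toLin' (p j))) : K) := by
      rw [← Matrix.trace_toLin'_eq]
      refine (LinearMap.IsIdempotentElem.isProj_range _ ?_).trace
      rw [IsIdempotentElem, Module.End.mul_eq_comp, ← Matrix.toLin'_mul, hpp]
    rw [← mul_one (M ^ k), ← hsum, Finset.mul_sum, trace_sum]
    refine Finset.sum_congr rfl fun j _ => ?_
    rw [hMkp, trace_smul, ht, smul_eq_mul, mul_comm]
  · rw [← mul_one M, ← hsum, Finset.mul_sum]
    refine Finset.sum_congr rfl fun j _ => ?_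
    by_cases hj : finrank K (LinearMap.range (toLin' (p j))) = 0
    · have : p j = 0 := by
        rwa [Submodule.finrank_eq_zero, LinearMap.range_eq_bot, LinearEquiv.map_eq_zero_iff] at hj
      rw [this, mul_zero]
    · have := hMkp j 1
      have h1 : ω ^ (j : ℕ) = 1 := h j hj
      rwa [h1, pow_one, one_pow, one_smul] at this

variable (φ : algebraicClosure ℚ K →+* ℂ)

omit [IsAlgClosed K] in
theorem mem_algebraicClosure_of_pow_eq_one {n : ℕ} (hn : n ≠ 0) {ζ : K} (h : ζ ^ n = 1) :
    ζ ∈ algebraicClosure ℚ K := by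
  rw [mem_algebraicClosure_iff]
  exact IsAlgebraic.of_pow (Nat.pos_of_ne_zero hn) (h ▸ isAlgebraic_one)

/-- Traces of powers of a matrix of finite order, transported to the complex numbers. -/
theorem exists_map_trace_pow_eq_sum {m n : ℕ} [NeZero n] (M : Matrix (Fin m) (Fin m) K)
    (hM : M ^ n = 1) :
    ∃ (z : Fin n → ℂ) (c : Fin n → ℕ), (∀ j, z j ^ n = 1) ∧
      (∀ k : ℕ, ∃ x : algebraicClosure ℚ K, (x : K) = (M ^ k).trace ∧
        φ x = ∑ j, (c j : ℂ) * z j ^ k) ∧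
      ((∀ j, c j ≠ 0 → z j = 1) → M = 1) := by
  obtain ⟨ζ, c, hζ, htr, hone⟩ := exists_trace_pow_eq_sum M hM
  let ζ' (j : Fin n) : algebraicClosure ℚ K :=
    ⟨ζ j, mem_algebraicClosure_of_pow_eq_one (NeZero.ne n) (hζ j)⟩
  have hζ' (j) : ζ' j ^ n = 1 := Subtype.ext (hζ j)
  refine ⟨fun j => φ (ζ' j), c, fun j => ?_, fun k => ?_, fun h => hone fun j hj => ?_⟩
  · rw [← map_pow, hζ', map_one]
  · refine ⟨∑ j, (c j : algebraicClosure ℚ K) * ζ' j ^ k, ?_, by simp⟩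
    rw [htr]
    simp [ζ']
  · have := φ.injective ((h j hj).trans (map_one φ).symm)
    exact congrArg Subtype.val this

/-- The complex conjugate of the trace of a matrix of finite order is the trace of its inverse. -/
theorem exists_map_trace_inv_eq_conj {m n : ℕ} [NeZero n] (M M' : Matrix (Fin m) (Fin m) K)
    (hM : M ^ n = 1) (hMM' : M * M' = 1) :
    ∃ x y : algebraicClosure ℚ K, (x : K) = M.trace ∧ (y : K) = M'.trace ∧
      φ y = starRingEnd ℂ (φ x) := by
  obtain ⟨z, c, hz, htr, -⟩ := exists_map_trace_pow_eq_sum φ M hM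
  have hM' : M' = M ^ (n - 1) := by
    have h : M ^ (n - 1) * M = 1 := by rw [← pow_succ, Nat.sub_add_cancel (NeZero.pos n), hM]
    rw [← one_mul M', ← h, mul_assoc, hMM', mul_one]
  obtain ⟨x, hx, hφx⟩ := htr 1
  obtain ⟨y, hy, hφy⟩ := htr (n - 1)
  refine ⟨x, y, by rw [hx, pow_one], by rw [hy, hM'], ?_⟩
  rw [hφx, hφy, map_sum]
  refine Finset.sum_congr rfl fun j _ => ?_
  rw [map_mul, Complex.conj_natCast, pow_one,
    ← Complex.inv_eq_conj (Complex.norm_eq_one_of_pow_eq_one (hz j) (NeZero.ne n))]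
  congr 1
  refine eq_inv_of_mul_eq_one_left ?_
  rw [← pow_succ, Nat.sub_add_cancel (NeZero.pos n), hz]

/-- The real part of the trace of a matrix of finite order is at most its size, with equality only
for the identity matrix. -/
theorem re_map_trace_le {m n : ℕ} [NeZero n] (M : Matrix (Fin m) (Fin m) K)
    (hM : M ^ n = 1) (x : algebraicClosure ℚ K) (hx : (x : K) = M.trace) :
    (φ x).re ≤ m ∧ ((φ x).re = m → M = 1) := by
  obtain ⟨z, c, hz, htr, hone⟩ := exists_map_trace_pow_eq_sum φ M hM
  obtain ⟨x', hx', hφx'⟩ := htr 1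
  obtain ⟨y, hy, hφy⟩ := htr 0
  obtain rfl : x' = x := Subtype.ext (by rw [hx, hx', pow_one])
  obtain rfl : y = m := Subtype.ext (by rw [hy]; simp)
  have hm : (m : ℝ) = ∑ j, (c j : ℝ) := by
    have : (m : ℂ) = ∑ j, (c j : ℂ) := by simpa using hφy
    exact_mod_cast this
  have hre : (φ x').re = ∑ j, (c j : ℝ) * (z j).re := by
    rw [hφx']; simp
  have hle (j) : (c j : ℝ) * (z j).re ≤ c j :=
    mul_le_of_le_one_right (Nat.cast_nonneg _) ((Complex.re_le_norm _).trans 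
      (Complex.norm_eq_one_of_pow_eq_one (hz j) (NeZero.ne n)).le)
  rw [hre, hm]
  refine ⟨Finset.sum_le_sum fun j _ => hle j, fun h => hone fun j hj => ?_⟩
  have h1 := (Finset.sum_eq_sum_iff_of_le fun j _ => hle j).mp h j (Finset.mem_univ j)
  have h2 : (z j).re = 1 := mul_left_cancel₀ (Nat.cast_ne_zero.mpr hj) (h1.trans (mul_one _).symm)
  have h3 : (z j).im = 0 := by
    have := Complex.sq_norm (z j)
    rw [Complex.norm_eq_one_of_pow_eq_one (hz j) (NeZero.ne n), Complex.normSq_apply, h2] at this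
    nlinarith
  exact Complex.ext h2 h3

end RootsOfUnity

/-! ### Irreducible characters as traces of blocks -/

section BlockCharacters

variable {K G ι : Type*} [Field K] [Group G] [Fintype ι] [DecidableEq ι] {d : ι → ℕ}

/-- The representation of `G` on the column vectors of the block `i`. -/
def blockRep (γ : G →* MatProd K d) (i : ι) : Representation K G (Fin (d i) → K) :=
  (Matrix.toLinAlgEquiv' : Matrix (Fin (d i)) (Fin (d i)) K ≃ₐ[K] _).toMonoidHom.comp
    ((Pi.evalMonoidHom _ i).comp γ)

/-- The character of the column vectors of the block `i`. -/
def blockChar (γ : G →* MatProd K d) (i : ι) (g : G) : K :=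
  (γ g i).trace

omit [Fintype ι] [DecidableEq ι] in
theorem character_blockRep (γ : G →* MatProd K d) (i : ι) :
    (blockRep γ i).character = blockChar γ i := by
  ext g
  exact Matrix.trace_toLin'_eq _

variable {γ : G →* MatProd K d} (b : Basis G K (MatProd K d)) (hb : ∀ g, b g = γ g)

include b hb in
omit [Fintype ι] [DecidableEq ι] in
-- With U = ⊥ this reduces linear identities on the algebra to group elements.
theorem map_mem_of_forall_group {W : Type*} [AddCommGroup W] [Module K W] (U : Submodule K W)
    (L : MatProd K d →ₗ[K] W) (h : ∀ g, L (γ g) ∈ U) (x : MatProd K d) : L x ∈ U := by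
  have : Submodule.span K (Set.range b) ≤ U.comap L := by
    rw [Submodule.span_le]
    rintro _ ⟨g, rfl⟩
    rw [hb]
    exact h g
  exact this (b.span_eq ▸ Submodule.mem_top)

include b hb in
omit [Fintype ι] in
theorem blockRep_isIrreducible [∀ i, NeZero (d i)] (i : ι) : (blockRep γ i).IsIrreducible := by
  have hmem (U : Subrepresentation (blockRep γ i)) (u) (hu : u ∈ U.toSubmodule)
      (x : MatProd K d) : x i *ᵥ u ∈ U.toSubmodule := by
    exact map_mem_of_forall_group b hb U.toSubmodule
      ((Matrix.mulVecBilin K K).flip u ∘ₗ LinearMap.proj i) (fun g => U.apply_mem_toSubmodule g hu) x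
  have : Nontrivial (Subrepresentation (blockRep γ i)) := by
    refine ⟨⊥, ⊤, fun h => ?_⟩
    have h1 : (⊥ : Submodule K (Fin (d i) → K)) = ⊤ :=
      congrArg Subrepresentation.toSubmodule h
    exact bot_ne_top h1
  refine ⟨fun U => or_iff_not_imp_left.mpr fun hU => ?_⟩
  have hU' : U.toSubmodule ≠ ⊥ := fun h => hU (Subrepresentation.toSubmodule_injective h)
  obtain ⟨u, hu, hu0⟩ := (Submodule.ne_bot_iff _).mp hU'
  obtain ⟨k, hk⟩ := Function.ne_iff.mp hu0
  refine Subrepresentation.toSubmodule_injective ?_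
  refine (Submodule.eq_top_iff'.mpr fun w => ?_ : U.toSubmodule = ⊤)
  -- This rank one matrix sends the nonzero vector u to the arbitrary vector w.
  have := hmem U u hu (blockRankOne i w (Pi.single k (u k)⁻¹))
  rw [blockRankOne, Pi.single_eq_same, vecMulVec_mulVec] at this
  have hk' : u k ≠ 0 := hk
  simpa [hk'] using this

include b hb in
theorem eq_sum_blockChar [∀ i, NeZero (d i)] {ψ : G → K} (hψ : ∀ g h, ψ (g * h) = ψ (h * g)) :
    ∃ c : ι → K, ψ = ∑ i, c i • blockChar γ i := by
  let f : MatProd K d →ₗ[K] K := b.constr K ψ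
  have hf (g) : f (γ g) = ψ g := by rw [← hb]; exact b.constr_basis K ψ g
  have hc (x y : MatProd K d) : f (x * y) = f (y * x) := by
    have h0 (g) : f (γ g * y) - f (y * γ g) = 0 :=
      map_mem_of_forall_group b hb ⊥ (f ∘ₗ LinearMap.mulLeft K (γ g) - f ∘ₗ LinearMap.mulRight K (γ g))
        (fun h => by simp [← map_mul, hf, hψ g h]) y
    exact sub_eq_zero.mp <| map_mem_of_forall_group b hb ⊥
      (f ∘ₗ LinearMap.mulRight K y - f ∘ₗ LinearMap.mulLeft K y) h0 x
  refine ⟨fun i => f (blockUnit K i 0 0), ?_⟩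
  ext g
  rw [← hf, eq_sum_trace_of_mul_comm f hc]
  simp [blockChar]

include b hb in
omit [Fintype ι] in
theorem blockChar_injective [CharZero K] [∀ i, NeZero (d i)] :
    Function.Injective (blockChar γ) := by
  intro i j hij
  by_contra hne
  have h : (Matrix.traceLinearMap (Fin (d i)) K K) ∘ₗ LinearMap.proj i =
      (Matrix.traceLinearMap (Fin (d j)) K K) ∘ₗ
        (LinearMap.proj j : MatProd K d →ₗ[K] _) := by
    refine b.ext fun g => ?_
    rw [hb]
    exact congrFun hij g
  have h1 := LinearMap.congr_fun h (Pi.single i 1)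
  simp [Pi.single_eq_of_ne (Ne.symm hne), NeZero.ne] at h1

section Irreducible

variable [CharZero K] [IsAlgClosed K] [Fintype G] [∀ i, NeZero (d i)]
include b hb

omit [Fintype ι] [CharZero K] [IsAlgClosed K] [Fintype G] in
theorem blockChar_mem_Irr (i : ι) : blockChar γ i ∈ Irr K G :=
  ⟨d i, blockRep γ i, blockRep_isIrreducible b hb i, (character_blockRep γ i).symm⟩

omit [Group G] [Fintype G] [Fintype ι] [DecidableEq ι] [CharZero K] [IsAlgClosed K] b hb in
theorem charInner_sum_left [Group G] [Fintype G] {κ : Type*} (s : Finset κ) (c : κ → K)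
    (f : κ → G → K) (β : G → K) :
    charInner (∑ j ∈ s, c j • f j) β = ∑ j ∈ s, c j * charInner (f j) β := by
  simp only [charInner, Finset.sum_apply, Pi.smul_apply, smul_eq_mul, Finset.sum_mul,
    Finset.mul_sum]
  rw [Finset.sum_comm]
  exact Finset.sum_congr rfl fun j _ => Finset.sum_congr rfl fun g _ => by ring

/-- An irreducible character is a class function, so it is a combination of block characters. Were
it none of them, it would be orthogonal to all and hence to itself. -/
theorem range_blockChar : Set.range (blockChar γ) = Irr K G := by
  refine Set.Subset.antisymm (Set.range_subset_iff.mpr (blockChar_mem_Irr b hb)) fun ψ hψ => ?_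
  by_contra hne
  obtain ⟨n, σ, hσ, rfl⟩ := id hψ
  obtain ⟨c, hc⟩ := eq_sum_blockChar b hb (ψ := σ.character) fun g h => σ.char_mul_comm h g
  have h1 := (charInner_irr hψ hψ).1 rfl
  have h0 : charInner (∑ i, c i • blockChar γ i) σ.character = 0 := by
    rw [charInner_sum_left]
    refine Finset.sum_eq_zero fun i _ => ?_
    rw [(charInner_irr (blockChar_mem_Irr b hb i) hψ).2 fun h => hne ⟨i, h⟩, mul_zero]
  rw [← hc, h1] at h0
  exact one_ne_zero h0

theorem charInner_blockChar {χ : G → K} {m : ι → K} (hχ : χ = ∑ i, m i • blockChar γ i) (i : ι) :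
    charInner χ (blockChar γ i) = m i := by
  rw [hχ, charInner_sum_left, Finset.sum_eq_single i]
  · rw [(charInner_irr (blockChar_mem_Irr b hb i) (blockChar_mem_Irr b hb i)).1 rfl, mul_one]
  · intro j _ hj
    rw [(charInner_irr (blockChar_mem_Irr b hb j) (blockChar_mem_Irr b hb i)).2
      fun h => hj (blockChar_injective b hb h), mul_zero]
  · simp

theorem idealPart_eq_sum {χ : G → K} {m : ι → ℕ} (hχ : χ = ∑ i, (m i : K) • blockChar γ i) :
    idealPart χ = ∑ i with m i = d i, (d i : K) • blockChar γ i := by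
  classical
  have him : (irr_finite K G).toFinset = Finset.univ.image (blockChar γ) := by
    ext ψ
    simp [← range_blockChar b hb]
  have h1 (i) : blockChar γ i 1 = (d i : K) := by simp [blockChar]
  rw [idealPart, Finset.sum_filter, him, Finset.sum_image (blockChar_injective b hb).injOn,
    Finset.sum_filter]
  refine Finset.sum_congr rfl fun i _ => ?_
  rw [charInner_blockChar b hb hχ, h1]
  simp only [Nat.cast_inj]

theorem sub_idealPart_eq_sum {χ : G → K} {m : ι → ℕ} (hχ : χ = ∑ i, (m i : K) • blockChar γ i) :
    χ - idealPart χ = ∑ i with m i ≠ d i, (m i : K) • blockChar γ i := by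
  rw [idealPart_eq_sum b hb hχ, sub_eq_iff_eq_add]
  have : ∑ i with m i = d i, (d i : K) • blockChar γ i =
      ∑ i with m i = d i, (m i : K) • blockChar γ i :=
    Finset.sum_congr rfl fun i hi => by rw [(Finset.mem_filter.mp hi).2]
  rw [this, hχ, add_comm, Finset.sum_filter_add_sum_filter_not]

/-- The elements where `χ - χ_I` takes its maximal value are those that act trivially on all the
blocks occurring in `χ - χ_I`. -/
theorem mem_charKer_sub_idealPart_iff {χ : G → K} {m : ι → ℕ}
    (hχ : χ = ∑ i, (m i : K) • blockChar γ i) (g : G) :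
    g ∈ charKer (χ - idealPart χ) ↔ ∀ i, m i ≠ d i → m i ≠ 0 → γ g i = 1 := by
  have h1 (i) : blockChar γ i 1 = (d i : K) := by simp [blockChar]
  rw [charKer, Set.mem_ofPred_eq, sub_idealPart_eq_sum b hb hχ]
  simp only [Finset.sum_apply, Pi.smul_apply, smul_eq_mul, h1]
  constructor
  · intro h i hi h0
    obtain ⟨φ⟩ := nonempty_algebraicClosure_ringHom ℚ K ℂ
    have hpow (i) : γ g i ^ Fintype.card G = 1 := by
      rw [← Pi.pow_apply, ← map_pow, pow_card_eq_one, map_one, Pi.one_apply]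
    have hx (i) : ∃ x : algebraicClosure ℚ K, (x : K) = blockChar γ i g := by
      obtain ⟨x, -, hx, -⟩ := exists_map_trace_inv_eq_conj φ (γ g i) (γ g⁻¹ i) (hpow i)
        (by rw [← Pi.mul_apply, ← map_mul, mul_inv_cancel, map_one, Pi.one_apply])
      exact ⟨x, hx⟩
    choose x hx using hx
    have hle (i) := re_map_trace_le φ (γ g i) (hpow i) (x i) (hx i)
    have hsum : ∑ i with m i ≠ d i, (m i : algebraicClosure ℚ K) * x i =
        ∑ i with m i ≠ d i, (m i : algebraicClosure ℚ K) * (d i : algebraicClosure ℚ K) := by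
      refine Subtype.ext ?_
      push_cast
      simpa [hx] using h
    have hre : ∑ i with m i ≠ d i, (m i : ℝ) * (φ (x i)).re =
        ∑ i with m i ≠ d i, (m i : ℝ) * d i := by
      simpa using congrArg (fun z => (φ z).re) hsum
    -- Each term is bounded by its counterpart, so equality of the sums forces equality termwise.
    have := (Finset.sum_eq_sum_iff_of_le fun i _ =>
      mul_le_mul_of_nonneg_left (hle i).1 (Nat.cast_nonneg (m i))).mp hre i (by simp [hi])
    exact (hle i).2 (mul_left_cancel₀ (Nat.cast_ne_zero.mpr h0) this)
  · intro h
    refine Finset.sum_congr rfl fun i hi => ?_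
    by_cases h0 : m i = 0
    · simp [h0]
    · rw [blockChar, h i (Finset.mem_filter.mp hi).2 h0]
      simp

end Irreducible

end BlockCharacters

/-! ### Comparing orthogonal projections -/

section Positivity

open scoped ComplexOrder in
-- C - D is itself an orthogonal projection, and its trace is zero.
theorem eq_of_isHermitian_of_mul_eq {n : Type*} [Fintype n] {C D : Matrix n n ℂ}
    (hC : C.IsHermitian) (hD : D.IsHermitian) (hCC : C * C = C) (hDD : D * D = D)
    (hDC : D * C = D) (htr : C.trace = D.trace) : C = D := by
  have hCD : C * D = D := by
    rw [← hC.eq, ← hD.eq, ← conjTranspose_mul, hDC]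
  have hsq : (C - D)ᴴ * (C - D) = C - D := by
    rw [conjTranspose_sub, hC.eq, hD.eq, sub_mul, mul_sub, mul_sub, hCC, hDD, hDC, hCD]
    abel
  rw [← sub_eq_zero, ← trace_conjTranspose_mul_self_eq_zero_iff, hsq, trace_sub, htr, sub_self]

variable {K G : Type*} [Field K] [CharZero K] [Group G] [Fintype G]

/-- If the idempotent matrix `(f (h⁻¹ g))` and its conjugate by the permutation `π` have the same
kernel, then they agree, provided `f` takes conjugate values at inverse elements. -/
theorem apply_inv_mul_perm_eq (φ : algebraicClosure ℚ K →+* ℂ) (f : G → K)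
    (hf : ∀ g, ∃ x y : algebraicClosure ℚ K, (x : K) = f g ∧ (y : K) = f g⁻¹ ∧
      φ y = starRingEnd ℂ (φ x)) (π : Equiv.Perm G)
    (h1 : ∀ g h, ∑ k, f (h⁻¹ * k) * f (k⁻¹ * g) = f (h⁻¹ * g))
    (h2 : ∀ g h, ∑ k, f ((π h)⁻¹ * π k) * f (k⁻¹ * g) = f ((π h)⁻¹ * π g)) (g h : G) :
    f ((π h)⁻¹ * π g) = f (h⁻¹ * g) := by
  have ha (g) : ∃ x : algebraicClosure ℚ K, (x : K) = f g := (hf g).imp fun x hx => hx.choose_spec.1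
  choose a ha using ha
  have hconj (g) : φ (a g⁻¹) = starRingEnd ℂ (φ (a g)) := by
    obtain ⟨x, y, hx, hy, hxy⟩ := hf g
    rwa [Subtype.ext ((ha g).trans hx.symm), Subtype.ext ((ha g⁻¹).trans hy.symm)]
  have e1 (g h) : ∑ k, φ (a (h⁻¹ * k)) * φ (a (k⁻¹ * g)) = φ (a (h⁻¹ * g)) := by
    simp only [← map_mul, ← map_sum]
    congr 1
    refine Subtype.ext ?_
    push_cast
    simpa [ha] using h1 g h
  have e2 (g h) : ∑ k, φ (a ((π h)⁻¹ * π k)) * φ (a (k⁻¹ * g)) = φ (a ((π h)⁻¹ * π g)) := by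
    simp only [← map_mul, ← map_sum]
    congr 1
    refine Subtype.ext ?_
    push_cast
    simpa [ha] using h2 g h
  have key : (Matrix.of fun h g => φ (a (h⁻¹ * g))) =
      Matrix.of fun h g => φ (a ((π h)⁻¹ * π g)) := by
    refine eq_of_isHermitian_of_mul_eq ?_ ?_ ?_ ?_ ?_ ?_
    · ext h g
      simp [conjTranspose_apply, ← hconj]
    · ext h g
      simp [conjTranspose_apply, ← hconj]
    · ext h g
      simpa [Matrix.mul_apply] using e1 g h
    · ext h g
      simp only [Matrix.mul_apply, of_apply]
      rw [Equiv.sum_comp π (fun k => φ (a ((π h)⁻¹ * k)) * φ (a (k⁻¹ * π g))), e1]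
    · ext h g
      simpa [Matrix.mul_apply] using e2 g h
    · simp [Matrix.trace]
  have hgh := congrFun (congrFun key h) g
  rw [← ha, ← ha, φ.injective hgh]

end Positivity

/-! ### The projection to the full blocks, in the basis of group elements -/

section GroupAlgebra

variable {K G ι : Type*} [Field K] [CharZero K] [Group G] [Fintype G] [Fintype ι] [DecidableEq ι]
  {d : ι → ℕ} [∀ i, NeZero (d i)] {γ : G →* MatProd K d} (b : Basis G K (MatProd K d))
  (hb : ∀ g, b g = γ g)
include hb

/-- The coefficients of an element of the group algebra, in terms of the traces of its blocks. -/
theorem repr_apply_eq_sum_trace (x : MatProd K d) (h : G) :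
    b.repr x h = (Nat.card G : K)⁻¹ * ∑ i, (d i : K) * ((γ h⁻¹ * x) i).trace := by
  classical
  have hn : (Nat.card G : K) ≠ 0 := Nat.cast_ne_zero.mpr Nat.card_pos.ne'
  -- The character of the regular representation, where each block has multiplicity d i.
  have htr (g : G) : ∑ i, (d i : K) * (γ g i).trace = if g = 1 then (Nat.card G : K) else 0 := by
    have h1 := trace_apply_eq_sum (Algebra.lmul K (MatProd K d)) (γ g)
    simp only [blockMult_lmul] at h1
    rw [← h1, LinearMap.trace_eq_matrix_trace K b, Matrix.trace]
    have h2 (k : G) : (LinearMap.toMatrix b b (Algebra.lmul K (MatProd K d) (γ g))).diag k =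
        if g = 1 then 1 else 0 := by
      rw [Matrix.diag, LinearMap.toMatrix_apply, Algebra.coe_lmul_eq_mul, LinearMap.mul_apply', hb,
        ← map_mul, ← hb, b.repr_self, Finsupp.single_apply]
      simp
    simp only [h2]
    split_ifs <;> simp
  have h0 := map_mem_of_forall_group b hb ⊥
    (Finsupp.lapply h ∘ₗ b.repr.toLinearMap - (Nat.card G : K)⁻¹ • ∑ i, (d i : K) •
      (Matrix.traceLinearMap (Fin (d i)) K K ∘ₗ LinearMap.proj i ∘ₗ LinearMap.mulLeft K (γ h⁻¹)))
    (fun g => by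
      have h3 := htr (h⁻¹ * g)
      have h4 : b.repr (γ g) h = if h⁻¹ * g = 1 then 1 else 0 := by
        rw [← hb, b.repr_self, Finsupp.single_apply]
        simp [inv_mul_eq_one, eq_comm]
      simp only [map_mul] at h3
      simp only [Submodule.mem_bot, LinearMap.sub_apply, LinearMap.smul_apply, LinearMap.comp_apply,
        LinearMap.sum_apply, Finsupp.lapply_apply, LinearEquiv.coe_coe, h4]
      simp only [LinearMap.mulLeft_apply, LinearMap.proj_apply, traceLinearMap_apply, smul_eq_mul,
        h3]
      split_ifs <;> simp) x
  have h5 := sub_eq_zero.mp ((Submodule.mem_bot K).mp h0)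
  simpa using h5

variable [IsAlgClosed K]

/-- The central idempotent supported on the blocks of full multiplicity. -/
def fullIdempotent (K : Type*) [Field K] (m : ι → ℕ) : MatProd K d :=
  fun i => if m i = d i then 1 else 0

variable {χ : G → K} {m : ι → ℕ} (hχ : χ = ∑ i, (m i : K) • blockChar γ i)
include hχ

theorem repr_mul_fullIdempotent (g h : G) :
    b.repr (γ g * fullIdempotent K m) h = (Nat.card G : K)⁻¹ * idealPart χ (h⁻¹ * g) := by
  rw [repr_apply_eq_sum_trace b hb, idealPart_eq_sum b hb hχ, Finset.sum_filter, Finset.sum_apply]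
  congr 1
  refine Finset.sum_congr rfl fun i _ => ?_
  by_cases hi : m i = d i
  · simp [fullIdempotent, hi, blockChar]
  · simp [fullIdempotent, hi]

/-- The operator permuting the group elements by `π`. -/
abbrev permOperator (b : Basis G K (MatProd K d)) (π : Equiv.Perm G) :
    MatProd K d ≃ₗ[K] MatProd K d :=
  b.equiv b π

variable (π : Equiv.Perm G)

omit [CharZero K] [Fintype G] [Fintype ι] [DecidableEq ι] [∀ i, NeZero (d i)] [IsAlgClosed K] hχ in
theorem permOperator_apply (g : G) : permOperator b π (γ g) = γ (π g) := by
  rw [← hb, ← hb, Basis.equiv_apply]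

omit hb hχ [Group G] [CharZero K] [Fintype G] [Fintype ι] [DecidableEq ι] [∀ i, NeZero (d i)]
  [IsAlgClosed K] in
theorem repr_permOperator (x : MatProd K d) (g : G) :
    b.repr (permOperator b π x) (π g) = b.repr x g := by
  have h (y : MatProd K d) : b.repr y (π g) = (b.reindex π.symm).repr y g := by simp
  rw [h, permOperator, Basis.equiv, LinearEquiv.trans_apply, LinearEquiv.apply_symm_apply]

theorem permOperator_mul_fullIdempotent
    (ha : ∀ g h : G, idealPart χ ((π h)⁻¹ * π g) = idealPart χ (h⁻¹ * g)) (x : MatProd K d) :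
    permOperator b π (x * fullIdempotent K m) = permOperator b π x * fullIdempotent K m := by
  refine sub_eq_zero.mp <| map_mem_of_forall_group b hb ⊥
    ((permOperator b π).toLinearMap ∘ₗ LinearMap.mulRight K (fullIdempotent K m) -
      LinearMap.mulRight K (fullIdempotent K m) ∘ₗ (permOperator b π).toLinearMap) (fun g => ?_) x
  refine sub_eq_zero.mpr (b.repr.injective (Finsupp.ext fun h => ?_))
  obtain ⟨h, rfl⟩ := π.surjective h
  simp only [LinearMap.comp_apply, LinearMap.mulRight_apply, LinearEquiv.coe_coe]
  rw [repr_permOperator, permOperator_apply b hb, repr_mul_fullIdempotent b hb hχ,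
    repr_mul_fullIdempotent b hb hχ, ha]

/-- The hypothesis says that T preserves the kernel of the projection, that is DC = D for its matrix
C and the relabelled matrix D. Positivity in `apply_inv_mul_perm_eq` upgrades this one-sided
relation to D = C. -/
theorem idealPart_perm_eq
    (hT : ∀ x, x * fullIdempotent K m = 0 → permOperator b π x * fullIdempotent K m = 0) (g h : G) :
    idealPart χ ((π h)⁻¹ * π g) = idealPart χ (h⁻¹ * g) := by
  have hn : (Nat.card G : K) ≠ 0 := Nat.cast_ne_zero.mpr Nat.card_pos.ne'
  set e : MatProd K d := fullIdempotent K m with he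
  have hee : e * e = e := by
    ext i : 1
    by_cases hi : m i = d i <;> simp [he, fullIdempotent, hi]
  set f : G → K := fun g => (Nat.card G : K)⁻¹ * idealPart χ g with hf
  have hrepr (g h) : b.repr (γ g * e) h = f (h⁻¹ * g) := repr_mul_fullIdempotent b hb hχ g h
  have hexp (g) : γ g * e = ∑ k, f (k⁻¹ * g) • γ k := by
    conv_lhs => rw [← b.sum_repr (γ g * e)]
    simp only [hrepr, hb]
  obtain ⟨φ⟩ := nonempty_algebraicClosure_ringHom ℚ K ℂ
  have hpow (i g) : γ g i ^ Fintype.card G = 1 := by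
    rw [← Pi.pow_apply, ← map_pow, pow_card_eq_one, map_one, Pi.one_apply]
  have key := apply_inv_mul_perm_eq φ f (fun g => ?_) π (fun g h => ?_) (fun g h => ?_) g h
  · exact mul_left_cancel₀ (inv_ne_zero hn) key
  · have hxy (i) := exists_map_trace_inv_eq_conj φ (γ g i) (γ g⁻¹ i) (hpow i g)
        (by rw [← Pi.mul_apply, ← map_mul, mul_inv_cancel, map_one, Pi.one_apply])
    choose x y hx hy hxy using hxy
    refine ⟨(Nat.card G : algebraicClosure ℚ K)⁻¹ * ∑ i with m i = d i,
      (d i : algebraicClosure ℚ K) * x i, (Nat.card G : algebraicClosure ℚ K)⁻¹ *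
        ∑ i with m i = d i, (d i : algebraicClosure ℚ K) * y i, ?_, ?_, ?_⟩
    · simp [hf, idealPart_eq_sum b hb hχ, hx, blockChar]
    · simp [hf, idealPart_eq_sum b hb hχ, hy, blockChar]
    · simp [hxy]
  · have h1 : b.repr (γ g * e * e) h = f (h⁻¹ * g) := by rw [mul_assoc, hee, hrepr]
    rw [← h1, hexp, Finset.sum_mul, map_sum, Finset.sum_apply']
    refine Finset.sum_congr rfl fun k _ => ?_
    rw [smul_mul_assoc, map_smul, Finsupp.smul_apply, hrepr, smul_eq_mul, mul_comm]
  · have h0 := hT (γ g * e - γ g) (by rw [sub_mul, mul_assoc, hee, sub_self])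
    rw [map_sub, sub_mul, sub_eq_zero] at h0
    have h1 : b.repr (permOperator b π (γ g * e) * e) (π h) = f ((π h)⁻¹ * π g) := by
      rw [h0, permOperator_apply b hb, hrepr]
    rw [← h1, hexp, map_sum, Finset.sum_mul, map_sum, Finset.sum_apply']
    refine Finset.sum_congr rfl fun k _ => ?_
    rw [map_smul, permOperator_apply b hb, smul_mul_assoc, map_smul, Finsupp.smul_apply, hrepr,
      smul_eq_mul, mul_comm]

end GroupAlgebra

/-! ### Both implications, over the algebraically closed field -/

section Main

variable {K G ι : Type*} [Field K] [CharZero K] [IsAlgClosed K] [Group G] [Fintype G] [Fintype ι]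
  [DecidableEq ι] {d : ι → ℕ} [∀ i, NeZero (d i)] {γ : G →* MatProd K d}
  (b : Basis G K (MatProd K d)) (hb : ∀ g, b g = γ g)
  {W : Type*} [AddCommGroup W] [Module K W] [FiniteDimensional K W]
  (α : MatProd K d →ₐ[K] End K W) {χ : G → K} (hχ : ∀ g, χ g = LinearMap.trace K W (α (γ g)))
  {v : W} (hv : ∀ w, ∃ x, α x v = w) (π : Equiv.Perm G)

include hχ in
omit [CharZero K] [IsAlgClosed K] [Fintype G] in
theorem eq_sum_blockMult : χ = ∑ i, (blockMult α i : K) • blockChar γ i := by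
  ext g
  rw [hχ, trace_apply_eq_sum]
  simp [blockChar]

include hb hχ

theorem mem_charKer_iff (g : G) : g ∈ charKer (χ - idealPart χ) ↔
    ∀ i, blockMult α i ≠ d i → blockMult α i ≠ 0 → γ g i = 1 :=
  mem_charKer_sub_idealPart_iff b hb (eq_sum_blockMult α hχ) g

include hv

/-- Tx and π(1)x agree in all occurring blocks: both vanish in the full ones by `ha`, and they
coincide in the others by `hN`. Thus (Tx)v = π(1)(xv) = 0. -/
theorem apply_permOperator_eq_zero
    (ha : ∀ g h : G, idealPart χ ((π h)⁻¹ * π g) = idealPart χ (h⁻¹ * g))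
    (hN : ∀ g, (π 1 * g)⁻¹ * π g ∈ charKer (χ - idealPart χ)) (x : MatProd K d)
    (hx : α x v = 0) : α (permOperator b π x) v = 0 := by
  have h0 (i) (hi : blockMult α i = d i) : x i = 0 := block_eq_zero_of_apply_eq_zero α hv hi hx
  have hxe : x * fullIdempotent K (blockMult α) = 0 := by
    ext i : 1
    by_cases hi : blockMult α i = d i <;> simp [fullIdempotent, hi, h0]
  have hTe := permOperator_mul_fullIdempotent b hb (eq_sum_blockMult α hχ) π ha x
  rw [hxe, map_zero] at hTe
  have h1 (i) (hi : blockMult α i ≠ d i) (hi0 : blockMult α i ≠ 0) :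
      permOperator b π x i = γ (π 1) i * x i := by
    refine sub_eq_zero.mp <| map_mem_of_forall_group b hb ⊥
      ((LinearMap.proj i : MatProd K d →ₗ[K] Matrix (Fin (d i)) (Fin (d i)) K) ∘ₗ
        (permOperator b π).toLinearMap - LinearMap.proj i ∘ₗ LinearMap.mulLeft K (γ (π 1)))
      (fun g => ?_) x
    have h2 := (mem_charKer_iff b hb α hχ _).mp (hN g) i hi hi0
    have h3 : γ (π g) = γ (π 1) * γ g * γ ((π 1 * g)⁻¹ * π g) := by
      rw [← map_mul, ← map_mul, mul_inv_cancel_left]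
    rw [Submodule.mem_bot, LinearMap.sub_apply, sub_eq_zero, LinearMap.comp_apply,
      LinearMap.comp_apply, LinearEquiv.coe_coe, permOperator_apply b hb, LinearMap.mulLeft_apply,
      LinearMap.proj_apply, LinearMap.proj_apply, h3, Pi.mul_apply, h2, mul_one]
  have h4 : α (permOperator b π x - γ (π 1) * x) = 0 := by
    refine (apply_eq_zero_iff α _).mpr fun i hi0 => ?_
    by_cases hi : blockMult α i = d i
    · have h5 := congrFun hTe i
      simp only [Pi.mul_apply, fullIdempotent, hi, if_true, mul_one, Pi.zero_apply] at h5
      rw [Pi.sub_apply, Pi.mul_apply, h0 i hi, mul_zero, sub_zero, ← h5]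
    · simp [h1 i hi hi0]
  rw [map_sub, sub_eq_zero] at h4
  rw [h4, map_mul, Module.End.mul_apply, hx, map_zero]

variable (hT : ∀ u x : MatProd K d, IsUnit u → α x (α u v) = 0 →
  α (permOperator b π x) (α u v) = 0)
include hT

/-- Full blocks occur because d i ≠ 0, so T maps every non-full block to zero in them; this is the
kernel condition of `idealPart_perm_eq`. -/
theorem idealPart_perm_eq_of_generic (g h : G) :
    idealPart χ ((π h)⁻¹ * π g) = idealPart χ (h⁻¹ * g) := by
  refine idealPart_perm_eq b hb (eq_sum_blockMult α hχ) π (fun x hx => ?_) g h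
  have h0 (i) (hi : blockMult α i = d i) : x i = 0 := by
    simpa [fullIdempotent, hi] using congrFun hx i
  ext i : 1
  by_cases hi : blockMult α i = d i
  · have hi0 : blockMult α i ≠ 0 := hi ▸ NeZero.ne _
    have h1 : permOperator b π x i = 0 := by
      conv_lhs => rw [← Finset.univ_sum_single x]
      rw [map_sum, Finset.sum_apply]
      refine Finset.sum_eq_zero fun j _ => ?_
      by_cases hj : blockMult α j = d j
      · simp [h0 j hj]
      · exact apply_single_eq_zero_of_ne α (permOperator b π).toLinearMap hv hT hj hi0
          (fun h => hj (h ▸ hi)) _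
    simp [h1]
  · simp [fullIdempotent, hi]

/-- By (a), T commutes with the full idempotent, so full blocks contribute nothing to the non-full
block i. Hence (Tx)_i depends on x_i alone, by a left multiplication; x = 1 shows the factor to be
π(1), and x = g gives the claim. -/
theorem inv_mul_perm_mem_charKer_of_generic (g : G) :
    (π 1 * g)⁻¹ * π g ∈ charKer (χ - idealPart χ) := by
  refine (mem_charKer_iff b hb α hχ _).mpr fun i hi hi0 => ?_
  have ha := idealPart_perm_eq_of_generic b hb α hχ hv π hT
  have hS (x : MatProd K d) :
      permOperator b π x i = permOperator b π (Pi.single i 1) i * x i := by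
    conv_lhs => rw [← Finset.univ_sum_single x]
    rw [map_sum, Finset.sum_apply, Finset.sum_eq_single i]
    · exact apply_single_eq_mul α (permOperator b π).toLinearMap hv hT hi hi0 (x i)
    · intro j _ hji
      by_cases hj : blockMult α j = d j
      · have h1 : (Pi.single j (x j) : MatProd K d) =
            Pi.single j (x j) * fullIdempotent K (blockMult α) := by
          ext l : 1
          rcases eq_or_ne l j with rfl | hl
          · simp [fullIdempotent, hj]
          · simp [Pi.single_eq_of_ne hl]
        rw [h1, permOperator_mul_fullIdempotent b hb (eq_sum_blockMult α hχ) π ha]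
        simp [fullIdempotent, hi]
      · exact apply_single_eq_zero_of_ne α (permOperator b π).toLinearMap hv hT hj hi0 hji.symm _
    · simp
  have h1 := hS (γ 1)
  rw [permOperator_apply b hb, map_one γ, Pi.one_apply, mul_one] at h1
  have h2 := hS (γ g)
  rw [permOperator_apply b hb, ← h1] at h2
  rw [map_mul, Pi.mul_apply, h2, ← Pi.mul_apply, ← Pi.mul_apply, ← map_mul, ← map_mul,
    inv_mul_cancel, map_one, Pi.one_apply]

end Main

/-! ### Orbit symmetries and annihilators -/

section OrbitSymmetries

variable {k G V : Type*} [Field k] [Group G] [Fintype G] [AddCommGroup V] [Module k V]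

theorem finiteDimensional_of_mem_generators {ρ : Representation k G V} {v : V}
    (hv : v ∈ generators ρ) : FiniteDimensional k V :=
  ⟨⟨(Set.finite_range fun g => ρ g v).toFinset, by simpa [generators] using hv⟩⟩

theorem exists_sum_smul_eq_of_mem_generators {ρ : Representation k G V} {v : V}
    (hv : v ∈ generators ρ) (w : V) : ∃ a : G → k, ∑ g, a g • ρ g v = w :=
  (Submodule.mem_span_range_iff_exists_fun k).mp
    ((show Submodule.span k (Set.range fun g : G => ρ g v) = ⊤ from hv) ▸ Submodule.mem_top)

/-- A linear map on a cyclic module can be prescribed on the orbit of a generator as soon as the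
linear relations are respected. -/
theorem exists_linearMap_orbit {ρ : Representation k G V} {v : V} (hv : v ∈ generators ρ)
    {X : Type*} [AddCommGroup X] [Module k X] (Φ : G → X)
    (hΦ : ∀ a : G → k, ∑ g, a g • ρ g v = 0 → ∑ g, a g • Φ g = 0) :
    ∃ A : V →ₗ[k] X, ∀ g, A (ρ g v) = Φ g := by
  classical
  let L : (G → k) →ₗ[k] V := Fintype.linearCombination k (fun g => ρ g v)
  have hL : Function.Surjective L := exists_sum_smul_eq_of_mem_generators hv
  obtain ⟨s, hs⟩ := L.exists_rightInverse_of_surjective (LinearMap.range_eq_top.mpr hL)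
  refine ⟨Fintype.linearCombination k Φ ∘ₗ s, fun g => ?_⟩
  have h1 : L (s (ρ g v) - Pi.single g 1) = 0 := by
    have h2 : L (s (ρ g v)) = ρ g v := LinearMap.congr_fun hs _
    rw [map_sub, h2]
    simp [L]
  have h3 := hΦ _ h1
  rw [← Fintype.linearCombination_apply, map_sub, sub_eq_zero] at h3
  rw [LinearMap.comp_apply, h3]
  simp

/-- A permutation is an orbit symmetry of a generator if and only if it respects the annihilator
of the generator. -/
theorem mem_orbitSymmetries_iff {ρ : Representation k G V} {v : V} (hv : v ∈ generators ρ)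
    (π : Equiv.Perm G) : π ∈ orbitSymmetries ρ v ↔
      ∀ a : G → k, ∑ g, a g • ρ g v = 0 → ∑ g, a g • ρ (π g) v = 0 := by
  constructor
  · rintro ⟨A, hA⟩ a ha
    simpa [map_sum, hA] using congrArg A ha
  · intro h
    obtain ⟨A, hA⟩ := exists_linearMap_orbit hv (fun g => ρ (π g) v) h
    have := finiteDimensional_of_mem_generators hv
    have hsurj : Function.Surjective A := by
      rw [← LinearMap.range_eq_top, eq_top_iff, ← (show Submodule.span k _ = ⊤ from hv),
        Submodule.span_le]
      rintro _ ⟨g, rfl⟩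
      exact ⟨ρ (π.symm g) v, by rw [hA, Equiv.apply_symm_apply]⟩
    exact ⟨LinearEquiv.ofBijective A ⟨LinearMap.injective_iff_surjective.mpr hsurj, hsurj⟩, hA⟩

end OrbitSymmetries

/-! ### Zariski density: from coefficients in k to coefficients in K -/

section Descent

variable {G : Type*} [Group G] [Fintype G] [DecidableEq G]

/-- The matrix of right multiplication by `∑ c g • g` on the group algebra, acting on row
vectors. -/
def rightMulMatrix {B : Type*} (c : G → B) : Matrix G G B :=
  Matrix.of fun g h => c (g⁻¹ * h)

/-- A coordinate of the vector obtained from `a • adj(c) • (c • v)` by applying `π` to the group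
elements occurring in `a • adj(c)`. -/
def twistedSum {B : Type*} [CommRing B] (π : Equiv.Perm G) (c a r : G → B) : B :=
  ∑ h, ∑ x, (a ᵥ* (rightMulMatrix c).adjugate) h * c x * r (π h * x)

theorem map_twistedSum {B C : Type*} [CommRing B] [CommRing C] (f : B →+* C) (π : Equiv.Perm G)
    (c a r : G → B) : f (twistedSum π c a r) = twistedSum π (f ∘ c) (f ∘ a) (f ∘ r) := by
  have h : (rightMulMatrix (f ∘ c)).adjugate = (rightMulMatrix c).adjugate.map f := by
    rw [← RingHom.mapMatrix_apply, RingHom.map_adjugate]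
    rfl
  simp only [twistedSum, map_sum, map_mul, h, Matrix.vecMul, dotProduct, Matrix.map_apply,
    Function.comp_apply]

theorem map_det_rightMulMatrix {B C : Type*} [CommRing B] [CommRing C] (f : B →+* C) (c : G → B) :
    f (rightMulMatrix c).det = (rightMulMatrix (f ∘ c)).det := by
  rw [RingHom.map_det]
  rfl

/-- The twisted sum is polynomial in c, because the adjugate replaces the inverse. It vanishes on a
nonempty Zariski open set over the infinite field k, hence identically. -/
theorem twistedSum_eq_zero_of_forall {k K : Type*} [Field k] [Infinite k] [Field K] [Algebra k K]
    (π : Equiv.Perm G) (a r : G → k)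
    (h : ∀ c : G → k, (rightMulMatrix c).det ≠ 0 → twistedSum π c a r = 0) (c : G → K)
    (hc : (rightMulMatrix c).det ≠ 0) :
    twistedSum π c (algebraMap k K ∘ a) (algebraMap k K ∘ r) = 0 := by
  let X : G → MvPolynomial G k := MvPolynomial.X
  let C : k →+* MvPolynomial G k := MvPolynomial.C
  -- The factor det extends the vanishing to the points where c is not invertible.
  have h0 : twistedSum π X (C ∘ a) (C ∘ r) * (rightMulMatrix X).det = 0 := by
    refine MvPolynomial.funext fun c => ?_
    have hX : MvPolynomial.eval c ∘ X = c := by ext; simp [X]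
    have hC (f : G → k) : MvPolynomial.eval c ∘ C ∘ f = f := by ext; simp [C]
    rw [map_mul, map_twistedSum, map_det_rightMulMatrix, hX, hC, hC, map_zero]
    by_cases hd : (rightMulMatrix c).det = 0
    · rw [hd, mul_zero]
    · rw [h c hd, zero_mul]
  have h1 := congrArg (MvPolynomial.eval₂Hom (algebraMap k K) c) h0
  have hX : MvPolynomial.eval₂Hom (algebraMap k K) c ∘ X = c := by ext; simp [X]
  have hC (f : G → k) : MvPolynomial.eval₂Hom (algebraMap k K) c ∘ C ∘ f = algebraMap k K ∘ f := by
    ext; simp [C]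
  rw [map_mul, map_twistedSum, map_det_rightMulMatrix, hX, hC, hC, map_zero] at h1
  exact (mul_eq_zero.mp h1).resolve_right hc

section Representation

variable {k V : Type*} [Field k] [AddCommGroup V] [Module k V] (ρ : Representation k G V)

omit [DecidableEq G] in
theorem sum_smul_sum_smul (π : G → G) (y c : G → k) (v : V) :
    ∑ h, y h • ρ (π h) (∑ x, c x • ρ x v) = ∑ h, ∑ x, (y h * c x) • ρ (π h * x) v := by
  simp [Finset.smul_sum, smul_smul]

omit [DecidableEq G] in
theorem sum_smul_sum_smul_eq_vecMul (y c : G → k) (v : V) :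
    ∑ h, y h • ρ h (∑ x, c x • ρ x v) = ∑ g, (y ᵥ* rightMulMatrix c) g • ρ g v := by
  refine (sum_smul_sum_smul ρ id y c v).trans ?_
  simp only [Matrix.vecMul, dotProduct, Finset.sum_smul]
  conv_rhs => rw [Finset.sum_comm]
  refine Finset.sum_congr rfl fun h _ => ?_
  rw [← Equiv.sum_comp (Equiv.mulLeft h) (fun g => (y h * rightMulMatrix c h g) • ρ g v)]
  simp [rightMulMatrix]

theorem mem_generators_sum_smul {v : V} (hv : v ∈ generators ρ) {c : G → k}
    (hc : (rightMulMatrix c).det ≠ 0) : ∑ x, c x • ρ x v ∈ generators ρ := by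
  refine eq_top_iff.mpr ?_
  rw [← (show Submodule.span k _ = ⊤ from hv), Submodule.span_le]
  rintro _ ⟨g, rfl⟩
  have h := sum_smul_sum_smul_eq_vecMul ρ (Pi.single g 1 ᵥ* (rightMulMatrix c)⁻¹) c v
  rw [vecMul_vecMul, Matrix.nonsing_inv_mul _ (isUnit_iff_ne_zero.mpr hc), vecMul_one] at h
  have h1 : ∑ x, (Pi.single g 1 : G → k) x • ρ x v = ρ g v := by simp [Pi.single_apply]
  rw [h1] at h
  change ρ g v ∈ _
  rw [← h]
  exact Submodule.sum_mem _ fun x _ => Submodule.smul_mem _ _ (Submodule.subset_span ⟨x, rfl⟩)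

/-- Since adj(c) · c = det(c), the element a · adj(c) annihilates cv, which is again a generator; π
must respect this relation. -/
theorem twistedSum_eq_zero_of_mem_genericSymmetries {π : Equiv.Perm G}
    (hπ : π ∈ genericSymmetries ρ) {v : V} (hv : v ∈ generators ρ) (f : V →ₗ[k] k) {a c : G → k}
    (ha : ∑ g, a g • ρ g v = 0) (hc : (rightMulMatrix c).det ≠ 0) :
    twistedSum π c a (fun g => f (ρ g v)) = 0 := by
  have hv' := mem_generators_sum_smul ρ hv hc
  have h := (mem_orbitSymmetries_iff hv' π).mp (Set.mem_iInter₂.mp hπ _ hv')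
    (a ᵥ* (rightMulMatrix c).adjugate) (by
      rw [sum_smul_sum_smul_eq_vecMul, vecMul_vecMul, adjugate_mul, vecMul_smul, vecMul_one]
      simp only [Pi.smul_apply, smul_assoc, ← Finset.smul_sum, ha, smul_zero])
  rw [sum_smul_sum_smul ρ π] at h
  simpa [twistedSum] using congrArg f h

end Representation

end Descent

/-! ### Generic symmetries after extension of scalars -/

section BaseChange

variable {k K G V ι : Type*} [Field k] [Field K] [Algebra k K] [Group G] [Fintype G]
  [AddCommGroup V] [Module k V]

/-- Extension of scalars of a representation. -/
def baseChangeRep (K : Type*) [Field K] [Algebra k K] (ρ : Representation k G V) :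
    Representation K G (K ⊗[k] V) :=
  (Module.End.baseChangeHom k K V).toMonoidHom.comp ρ

omit [Fintype G] in
theorem baseChangeRep_apply_tmul (ρ : Representation k G V) (g : G) (t : K) (w : V) :
    baseChangeRep K ρ g (t ⊗ₜ w) = t ⊗ₜ ρ g w := rfl

variable [Fintype ι] [DecidableEq ι] {d : ι → ℕ} {γ : G →* MatProd K d}
  (b : Basis G K (MatProd K d)) (hb : ∀ g, b g = γ g)

include hb in
omit [Fintype ι] [DecidableEq ι] in
theorem sum_repr_smul (x : MatProd K d) : ∑ g, b.repr x g • γ g = x := by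
  simpa only [hb] using b.sum_repr x

section

variable {W : Type*} [AddCommGroup W] [Module K W] {α : MatProd K d →ₐ[K] End K W}
  {σ : Representation K G W} (hα : ∀ g, α (γ g) = σ g)
include hα

omit [Fintype ι] [DecidableEq ι] in
theorem apply_sum_smul (y : G → K) (w : W) : α (∑ g, y g • γ g) w = ∑ g, y g • σ g w := by
  simp [hα]

include hb

omit [Fintype ι] [DecidableEq ι] in
theorem apply_eq_sum_repr (x : MatProd K d) (w : W) : α x w = ∑ g, b.repr x g • σ g w := by
  conv_lhs => rw [← sum_repr_smul b hb x]
  exact apply_sum_smul hα _ _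

end

variable [DecidableEq G]

omit [DecidableEq ι] [Fintype ι] [DecidableEq G] in
include hb in
theorem sum_smul_mul_eq_vecMul (y : G → K) (u : MatProd K d) :
    (∑ h, y h • γ h) * u = ∑ g, (y ᵥ* rightMulMatrix (b.repr u)) g • γ g := by
  have h := sum_smul_sum_smul_eq_vecMul
    ((Algebra.lmul K (MatProd K d)).toMonoidHom.comp γ) y (b.repr u) 1
  have h1 (g : G) (z : MatProd K d) :
      ((Algebra.lmul K (MatProd K d)).toMonoidHom.comp γ) g z = γ g * z := rfl
  simp only [h1, mul_one] at h
  rw [sum_repr_smul b hb] at h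
  rw [← h, Finset.sum_mul]
  simp only [smul_mul_assoc]

omit [DecidableEq ι] [Fintype ι] in
include hb in
-- Right multiplication by a unit is injective.
theorem det_rightMulMatrix_ne_zero {u : MatProd K d} (hu : IsUnit u) :
    (rightMulMatrix (b.repr u)).det ≠ 0 := by
  intro h
  obtain ⟨y, hy0, hy⟩ := Matrix.exists_vecMul_eq_zero_iff.mpr h
  have h1 := sum_smul_mul_eq_vecMul b hb y u
  rw [hy] at h1
  simp only [Pi.zero_apply, zero_smul, Finset.sum_const_zero] at h1
  have h2 := hu.mul_left_eq_zero.mp h1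
  simp only [← hb] at h2
  exact hy0 (funext (Fintype.linearIndependent_iff.mp b.linearIndependent y h2))

variable [Infinite k] {ρ : Representation k G V} {α : MatProd K d →ₐ[K] End K (K ⊗[k] V)}
  (hα : ∀ g, α (γ g) = baseChangeRep K ρ g)
include hb hα

omit [Fintype ι] [DecidableEq ι] [DecidableEq G] in
/-- Generic symmetries respect the annihilators of all the unit multiples of a generator after
extension of scalars. -/
theorem apply_permOperator_eq_zero_of_mem_genericSymmetries {π : Equiv.Perm G}
    (hπ : π ∈ genericSymmetries ρ) {v : V} (hv : v ∈ generators ρ) {u : MatProd K d}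
    (hu : IsUnit u) {x : MatProd K d} (hx : α x (α u (1 ⊗ₜ v)) = 0) :
    α (permOperator b π x) (α u (1 ⊗ₜ v)) = 0 := by
  classical
  obtain ⟨u', huu'⟩ := hu.exists_right_inv
  set c : G → K := ⇑(b.repr u)
  have hdet : (rightMulMatrix c).det ≠ 0 := det_rightMulMatrix_ne_zero b hb hu
  let v1 : K ⊗[k] V := 1 ⊗ₜ v
  have hperm (y : G → K) : permOperator b π (∑ g, y g • γ g) = ∑ g, y g • γ (π g) := by
    simp [permOperator_apply b hb]
  -- The assignment gv ↦ T(g u⁻¹)(u v1) respects the k-linear relations of the orbit of v. Replacing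
  -- u⁻¹ by the adjugate over the determinant reduces this to a twisted sum.
  have hrel (a : G → k) (ha : ∑ g, a g • ρ g v = 0) :
      ∑ g, a g • α (permOperator b π (γ g * u')) (α u v1) = 0 := by
    set y : G → K := (algebraMap k K ∘ a) ᵥ* (rightMulMatrix c).adjugate with hy
    have h1 : (∑ h, y h • γ h) * u = (rightMulMatrix c).det • ∑ g, algebraMap k K (a g) • γ g := by
      rw [sum_smul_mul_eq_vecMul b hb, vecMul_vecMul, adjugate_mul, vecMul_smul, vecMul_one]
      simp only [Pi.smul_apply, smul_assoc, ← Finset.smul_sum, Function.comp_apply]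
    have h2 : ∑ g, algebraMap k K (a g) • (γ g * u') =
        (rightMulMatrix c).det⁻¹ • ∑ h, y h • γ h := by
      have h3 := congrArg (· * u') h1
      simp only [mul_assoc, huu', mul_one] at h3
      rw [h3, smul_mul_assoc, smul_smul, inv_mul_cancel₀ hdet, one_smul, Finset.sum_mul]
      simp only [smul_mul_assoc]
    have h4 : ∑ h, ∑ x, (y h * c x) • baseChangeRep K ρ (π h * x) v1 = 0 := by
      let β := (Basis.ofVectorSpace k V).baseChange K
      refine β.ext_elem fun j => ?_
      have h5 := twistedSum_eq_zero_of_forall (K := K) π a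
        (fun g => (Basis.ofVectorSpace k V).coord j (ρ g v))
        (fun c' hc' => twistedSum_eq_zero_of_mem_genericSymmetries ρ hπ hv _ ha hc') c hdet
      rw [twistedSum] at h5
      simp only [map_sum, map_smul, Finsupp.finsetSum_apply, Finsupp.smul_apply, v1,
        baseChangeRep_apply_tmul, β, Basis.baseChange_repr_tmul, map_zero, Finsupp.zero_apply]
      simpa [Algebra.smul_def, mul_assoc] using h5
    have h6 : ∑ g, a g • α (permOperator b π (γ g * u')) (α u v1) =
        α (permOperator b π (∑ g, algebraMap k K (a g) • (γ g * u'))) (α u v1) := by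
      simp only [map_sum, map_smul, LinearMap.sum_apply, LinearMap.smul_apply]
      simp only [algebraMap_smul]
    rw [h6, h2, map_smul, map_smul, LinearMap.smul_apply, hperm]
    have h7 : α (∑ g, y g • γ (π g)) (α u v1) =
        ∑ h, ∑ x, (y h * c x) • baseChangeRep K ρ (π h * x) v1 := by
      rw [← sum_smul_sum_smul (baseChangeRep K ρ) π, ← apply_eq_sum_repr b hb hα u v1]
      simp [hα]
    rw [h7, h4, smul_zero]
  -- The K-linear extension of A sends (xu)v1 to (Tx)(u v1), and (xu)v1 = 0.
  obtain ⟨A, hA⟩ := exists_linearMap_orbit hv _ hrel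
  have hx' : α (x * u) v1 = 0 := by rw [map_mul, Module.End.mul_apply]; exact hx
  have h8 := congrArg (A.liftBaseChange K) (apply_eq_sum_repr b hb hα (x * u) v1)
  rw [hx', map_zero, map_sum] at h8
  simp only [map_smul, v1, baseChangeRep_apply_tmul, LinearMap.liftBaseChange_tmul, one_smul,
    hA] at h8
  have h9 : permOperator b π x = ∑ g, b.repr (x * u) g • permOperator b π (γ g * u') := by
    conv_lhs => rw [← mul_one x, ← huu', ← mul_assoc, ← sum_repr_smul b hb (x * u)]
    simp [Finset.sum_mul]
  rw [h9, map_sum, LinearMap.sum_apply]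
  simpa using h8.symm

end BaseChange

/-! ### The coset condition, elementwise -/

section Cosets

variable {G : Type*} [Group G]

theorem forall_image_smul_eq_iff (H : Subgroup G) (π : Equiv.Perm G) :
    (∀ g : G, π '' (g • (H : Set G)) = (π 1 * g) • (H : Set G)) ↔
      ∀ g, (π 1 * g)⁻¹ * π g ∈ H := by
  have hmem (a x : G) : x ∈ a • (H : Set G) ↔ a⁻¹ * x ∈ H := by
    rw [Set.mem_smul_set_iff_inv_smul_mem]; rfl
  constructor
  · intro h g
    rw [← hmem, ← h g]
    exact ⟨g, (hmem g g).mpr (by simp [H.one_mem]), rfl⟩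
  · intro h g
    ext y
    obtain ⟨x, rfl⟩ := π.surjective y
    rw [π.injective.mem_set_image, hmem, hmem]
    -- The last factor lies in H, so π x ∈ π(1)gH exactly when x ∈ gH; normality of H plays no role.
    have e : (π 1 * g)⁻¹ * π x = g⁻¹ * x * ((π 1 * x)⁻¹ * π x) := by group
    rw [e, H.mul_mem_cancel_right (h x)]

end Cosets

/-- The group algebra over an algebraically closed field of characteristic zero is a product of
matrix algebras. -/
theorem exists_algEquiv_matProd (K G : Type*) [Field K] [CharZero K] [IsAlgClosed K] [Group G]
    [Fintype G] : ∃ (n : ℕ) (d : Fin n → ℕ), (∀ i, NeZero (d i)) ∧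
      Nonempty (MonoidAlgebra K G ≃ₐ[K] MatProd K d) := by
  have : NeZero (Nat.card G : K) := ⟨Nat.cast_ne_zero.mpr Nat.card_pos.ne'⟩
  have : FiniteDimensional K (MonoidAlgebra K G) := .of_basis (MonoidAlgebra.basis G K)
  exact IsSemisimpleRing.exists_algEquiv_pi_matrix_of_isAlgClosed K (MonoidAlgebra K G)

end GenericSymmetry

end

open GenericSymmetry Module TensorProduct in
theorem theoremB {k K G V : Type*} [Field k] [CharZero k] [Field K] [CharZero K] [IsAlgClosed K]
    [Algebra k K] [Group G] [Fintype G] [AddCommGroup V] [Module k V]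
    (ρ : Representation k G V) (hρ : GenericSymmetry.IsCyclicRep ρ)
    (χ : G → K) (hχ : ∀ g : G, χ g = algebraMap k K (ρ.character g))
    (N : Set G) (hN : N = GenericSymmetry.charKer (χ - GenericSymmetry.idealPart χ))
    (π : Equiv.Perm G) :
    π ∈ GenericSymmetry.genericSymmetries ρ ↔
      (∀ g h : G, GenericSymmetry.idealPart χ ((π h)⁻¹ * π g) =
        GenericSymmetry.idealPart χ (h⁻¹ * g)) ∧
      (∀ g : G, π '' (g • N) = (π 1 * g) • N) := by
  obtain ⟨n, d, hd, ⟨e⟩⟩ := exists_algEquiv_matProd K G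
  let γ : G →* MatProd K d := e.toMulEquiv.toMonoidHom.comp (MonoidAlgebra.of K G)
  let b : Basis G K (MatProd K d) := (MonoidAlgebra.basis G K).map e.toLinearEquiv
  have hb (g) : b g = γ g := by simp [b, γ]
  let α : MatProd K d →ₐ[K] End K (K ⊗[k] V) :=
    (MonoidAlgebra.lift K _ G (baseChangeRep K ρ)).comp e.symm.toAlgHom
  have hα (g) : α (γ g) = baseChangeRep K ρ g := by simp [α, γ]
  obtain ⟨v₀, hv₀⟩ := hρ
  have := finiteDimensional_of_mem_generators hv₀
  have hχα (g) : χ g = LinearMap.trace K (K ⊗[k] V) (α (γ g)) := by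
    rw [hα, hχ]
    exact (LinearMap.trace_baseChange (ρ g) K).symm
  have hgen {v : V} (hv : v ∈ generators ρ) (w : K ⊗[k] V) : ∃ x, α x (1 ⊗ₜ v) = w := by
    induction w with
    | zero => exact ⟨0, by simp⟩
    | add w w' hw hw' =>
      obtain ⟨x, rfl⟩ := hw
      obtain ⟨x', rfl⟩ := hw'
      exact ⟨x + x', by simp⟩
    | tmul t w =>
      obtain ⟨a, rfl⟩ := exists_sum_smul_eq_of_mem_generators hv w
      refine ⟨t • ∑ g, algebraMap k K (a g) • γ g, ?_⟩
      rw [map_smul, LinearMap.smul_apply, apply_sum_smul hα]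
      simp [baseChangeRep_apply_tmul, tmul_sum, tmul_smul, Finset.smul_sum, smul_tmul']
  -- The set N is a subgroup, as the common kernel of the occurring non-full blocks.
  obtain ⟨H, hH⟩ : ∃ H : Subgroup G, (H : Set G) = N := by
    refine ⟨⨅ i : {i // blockMult α i ≠ d i ∧ blockMult α i ≠ 0},
      ((Pi.evalMonoidHom _ i.1).comp γ).ker, ?_⟩
    ext g
    rw [hN, mem_charKer_iff b hb α hχα]
    simp [MonoidHom.mem_ker]
  rw [← hH, forall_image_smul_eq_iff]
  have hHN (g) : g ∈ H ↔ g ∈ charKer (χ - idealPart χ) := by rw [← hN, ← hH]; rfl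
  simp only [hHN]
  constructor
  · intro hπ
    have hT (u x : MatProd K d) (hu : IsUnit u) (hx : α x (α u (1 ⊗ₜ v₀)) = 0) :=
      apply_permOperator_eq_zero_of_mem_genericSymmetries b hb hα hπ hv₀ hu hx
    exact ⟨idealPart_perm_eq_of_generic b hb α hχα (hgen hv₀) π hT,
      inv_mul_perm_mem_charKer_of_generic b hb α hχα (hgen hv₀) π hT⟩
  · rintro ⟨h1, h2⟩
    refine Set.mem_iInter₂.mpr fun v hv => (mem_orbitSymmetries_iff hv π).mpr fun a ha => ?_
    -- A relation over k may be tested in K ⊗ V because w ↦ 1 ⊗ w is injective.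
    have hsum (π' : G → G) : α (∑ g, algebraMap k K (a g) • γ (π' g)) (1 ⊗ₜ v) =
        1 ⊗ₜ ∑ g, a g • ρ (π' g) v := by
      simp only [map_sum, map_smul, LinearMap.sum_apply, LinearMap.smul_apply, hα,
        baseChangeRep_apply_tmul]
      simp only [algebraMap_smul, tmul_sum, tmul_smul]
    have h3 := apply_permOperator_eq_zero b hb α hχα (hgen hv) π h1 h2
      (∑ g, algebraMap k K (a g) • γ g) ((hsum id).trans (by simp [ha]))
    simp only [map_sum, map_smul, permOperator_apply b hb] at h3
    have h4 := hsum π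
    simp only [map_sum, map_smul] at h4
    rw [h4] at h3
    simpa using h3
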